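/- **Theorem (Mixed embeddings).** Let $n\ge 1$, let $\mathbb{R}^{1+n}_+=\{(t,x): t>0,\ x\in\mathbb{R}^n\}$, and let $F$ be a normed space; $L^0$ denotes the space of (a.e.-classes of) strongly measurable functions $f:\mathbb{R}^{1+n}_+\to F$. An *exponent* $\mathbf{p}$ is either a pair $(p,s)$ with $0<p<\infty$, $s\in\mathbb{R}$ (finite exponent), with $j(\mathbf{p})=1/p$ and $\theta(\mathbf{p})=s$, or a triple $(\infty,s;\alpha)$ with $s\in\mathbb{R}$, $\alpha\ge 0$ (infinite exponent), with $j(\mathbf{p})=-\alpha/n$ and $\theta(\mathbf{p})=s$. Write $\mathbf{p}\hookrightarrow\mathbf{q}$ if $\theta(\mathbf{p})-\theta(\mathbf{q})=n\,(j(\mathbf{p})-j(\mathbf{q}))$ and $\theta(\mathbf{q})\le\theta(\mathbf{p})$. The tent space $T^{\mathbf{p}}$ consists of all $f\in L^0$ with $\|f\|_{T^{\mathbf{p}}}<\infty$, where $$\|f\|_{T^{(p,s)}}=\Big(\int_{\mathbb{R}^n}\Big(\iint_{|y-x|<t}|t^{-s}f(t,y)|^2\,\frac{dy\,dt}{t^{n+1}}\Big)^{p/2}dx\Big)^{1/p},$$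 $$\|f\|_{T^{(\infty,s;\alpha)}}=\sup_{B}\ r_B^{-\alpha}\Big(\frac1{|B|}\iint_{T(B)}|t^{-s}f(t,y)|^2\,\frac{dy\,dt}{t}\Big)^{1/2},$$ the supremum being over all balls $B\subset\mathbb{R}^n$, with radius $r_B$ and tent $T(B)=\{(t,y)\in\mathbb{R}^{1+n}_+: B(y,t)\subset B\}$. For a Whitney parameter $c=(c_0,c_1)$ with $c_0>0$, $c_1>1$, put $$\mathcal{W}_cf(t,x)=\Big(\frac{1}{|\Omega_c(t,x)|}\iint_{\Omega_c(t,x)}|f|^2\Big)^{1/2},\qquad \Omega_c(t,x)=(c_1^{-1}t,c_1t)\times B(x,c_0t).$$ The space $Z^{\mathbf{p}}=Z^{\mathbf{p}}_c$ consists of all $f\in L^0$ with $\|f\|_{Z^{\mathbf{p}}_c}<\infty$, where $\|f\|_{Z^{(p,s)}_c}=\|\mathcal{W}_c(t^{-s}f)\|_{L^p(\mathbb{R}^{1+n}_+,\,dx\,dt/t)}$ and $\|f\|_{Z^{(\infty,s;\alpha)}_c}=\|\mathcal{W}_c(t^{-(s+\alpha)}f)\|_{L^\infty(\mathbb{R}^{1+n}_+)}$.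 Let $X_0,X_1\in\{T,Z\}$ and let $\mathbf{p}\hookrightarrow\mathbf{q}$ be exponents with $\mathbf{p}\ne\mathbf{q}$. Then $(X_0)^{\mathbf{p}}\hookrightarrow(X_1)^{\mathbf{q}}$: one has $(X_0)^{\mathbf{p}}\subset(X_1)^{\mathbf{q}}$, and there is a constant $C<\infty$ such that $$\|f\|_{(X_1)^{\mathbf{q}}}\le C\,\|f\|_{(X_0)^{\mathbf{p}}}\qquad\text{for all } f\in(X_0)^{\mathbf{p}}.$$ This holds for every choice of Whitney parameters $c$ and $d$ in the definitions of the $Z$-spaces on the left and on the right, respectively (with $C$ allowed to depend on them). -/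

import Mathlib

open MeasureTheory
open scoped ENNReal NNReal

namespace FractionalData

noncomputable section

/-- Exponents: finite exponents `(p, s)` with `0 < p < ∞` and `s ∈ ℝ`, and infinite exponents
`(∞, s; α)` with `s ∈ ℝ` and `α ≥ 0`. -/
inductive Exponent : Type
  | finite (p s : ℝ) (hp : 0 < p) : Exponent
  | infinite (s α : ℝ) (hα : 0 ≤ α) : Exponent

namespace Exponent

/-- Integrability `i(𝐩) ∈ (0, ∞]`. -/
def i : Exponent → ℝ≥0∞
  | finite p _ _ => ENNReal.ofReal p
  | infinite _ _ _ => ∞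

/-- The coordinate `j(𝐩)`: it is `1 / p` for `(p, s)` and `-α / n` for `(∞, s; α)`. -/
def j (n : ℕ) : Exponent → ℝ
  | finite p _ _ => 1 / p
  | infinite _ α _ => -α / n

/-- The coordinate `θ(𝐩) = s`. -/
def θ : Exponent → ℝ
  | finite _ s _ => s
  | infinite s _ _ => s

/-- The regularity that enters the `Z`-space norm: `s` for `(p, s)` and `s + α` for
`(∞, s; α)`. -/
def reg : Exponent → ℝ
  | finite _ s _ => s
  | infinite s α _ => s + α

/-- The relation `𝐩 ↪ 𝐪` between exponents. -/
def Embeds (n : ℕ) (p q : Exponent) : Prop :=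
  p.θ - q.θ = n * (p.j n - q.j n) ∧ q.θ ≤ p.θ

end Exponent

/-- `ℝ × ℝⁿ`, with the Euclidean norm on `ℝⁿ`; points are written `(t, x)`. -/
abbrev Space (n : ℕ) : Type := ℝ × EuclideanSpace ℝ (Fin n)

/-- The open upper half-space `{(t, x) : t > 0}`. -/
def upperHalf (n : ℕ) : Set (Space n) := {z | 0 < z.1}

/-- `L⁰`: a.e.-classes of strongly measurable `F`-valued functions on the upper half-space, with
respect to Lebesgue measure. -/
abbrev L0 (n : ℕ) (F : Type*) [NormedAddCommGroup F] : Type _ :=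
  Space n →ₘ[(volume : Measure (Space n)).restrict (upperHalf n)] F

/-- The measure `dx dt / t` on the upper half-space. -/
def haarUpper (n : ℕ) : Measure (Space n) :=
  ((volume : Measure (Space n)).restrict (upperHalf n)).withDensity
    fun z => ENNReal.ofReal (1 / z.1)

section Norms

variable {n : ℕ} {F : Type*} [NormedAddCommGroup F]

/-- Multiplication by a power of `t`: `(κ^σ f)(t, x) = t^σ f(t, x)`. -/
def kappa [NormedSpace ℝ F] (σ : ℝ) (f : Space n → F) : Space n → F :=
  fun z => (z.1 ^ σ) • f z

/-- The cone `Γ(x) = {(t, y) : t > 0, |y - x| < t}`. -/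
def cone (x : EuclideanSpace ℝ (Fin n)) : Set (Space n) :=
  {z | 0 < z.1 ∧ dist z.2 x < z.1}

/-- The tent `T(B)` over the ball `B = B(x, r)`, that is, the set of all `(t, y)` with `t > 0` and
`B(y, t) ⊆ B(x, r)`. -/
def tent (x : EuclideanSpace ℝ (Fin n)) (r : ℝ) : Set (Space n) :=
  {z | 0 < z.1 ∧ dist z.2 x + z.1 ≤ r}

/-- The conical square function
`𝓐f(x) = (∬_{Γ(x)} |f(t, y)|² dy dt / t^{n+1})^{1/2}`. -/
def conical (f : Space n → F) (x : EuclideanSpace ℝ (Fin n)) : ℝ≥0∞ :=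
  (∫⁻ z in cone x, ‖f z‖ₑ ^ 2 * ENNReal.ofReal (1 / z.1 ^ (n + 1))) ^ (1 / 2 : ℝ)

/-- The weighted Carleson norm
`sup_B r_B^{-α} (|B|⁻¹ ∬_{T(B)} |f(t, y)|² dy dt / t)^{1/2}`, the supremum being over all balls. -/
def carleson (α : ℝ) (f : Space n → F) : ℝ≥0∞ :=
  ⨆ (x : EuclideanSpace ℝ (Fin n)) (r : ℝ) (_ : 0 < r),
    ENNReal.ofReal (r ^ (-α)) *
      ((volume (Metric.ball x r))⁻¹ *
        ∫⁻ z in tent x r, ‖f z‖ₑ ^ 2 * ENNReal.ofReal (1 / z.1)) ^ (1 / 2 : ℝ)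

/-- Whitney parameters `c = (c₀, c₁)` with `c₀ > 0` and `c₁ > 1`. -/
structure Whitney : Type where
  c₀ : ℝ
  c₁ : ℝ
  c₀_pos : 0 < c₀
  one_lt_c₁ : 1 < c₁

/-- The Whitney region `Ω_c(t, x) = (c₁⁻¹ t, c₁ t) × B(x, c₀ t)`. -/
def Whitney.region (c : Whitney) (z : Space n) : Set (Space n) :=
  Set.Ioo (c.c₁⁻¹ * z.1) (c.c₁ * z.1) ×ˢ Metric.ball z.2 (c.c₀ * z.1)

/-- The Whitney average `𝓦_c f(t, x) = (⨍_{Ω_c(t, x)} |f|²)^{1/2}` (Lebesgue average). -/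
def Whitney.average (c : Whitney) (f : Space n → F) (z : Space n) : ℝ≥0∞ :=
  (⨍⁻ w in c.region z, ‖f w‖ₑ ^ 2 ∂volume) ^ (1 / 2 : ℝ)

variable [NormedSpace ℝ F]

/-- The tent space quasi-norm: `‖𝓐(t^{-s} f)‖_{L^p(ℝⁿ)}` for the exponent `(p, s)`, and the
weighted Carleson norm of `t^{-s} f` for the exponent `(∞, s; α)`. -/
def tentNorm (f : Space n → F) : Exponent → ℝ≥0∞
  | .finite p s _ => eLpNorm (conical (kappa (-s) f)) (ENNReal.ofReal p) volume
  | .infinite s α _ => carleson α (kappa (-s) f)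

/-- The `Z`-space quasi-norm: `‖𝓦_c(t^{-s} f)‖_{L^p(dx dt / t)}` for the exponent `(p, s)`, and
`‖𝓦_c(t^{-(s + α)} f)‖_{L^∞}` for the exponent `(∞, s; α)`. -/
def zNorm (c : Whitney) (f : Space n → F) (p : Exponent) : ℝ≥0∞ :=
  eLpNorm (c.average (kappa (-p.reg) f)) p.i (haarUpper n)

end Norms

/-- The two scales of function spaces. -/
inductive Scale : Type
  | T : Scale
  | Z : Scale

/-- The quasi-norm of `X^𝐩` for `X ∈ {T, Z}`; the Whitney parameter `c` is used for `X = Z`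
only. -/
def Scale.qnorm {n : ℕ} {F : Type*} [NormedAddCommGroup F] [NormedSpace ℝ F]
    (X : Scale) (c : Whitney) (p : Exponent) (f : L0 n F) : ℝ≥0∞ :=
  match X with
  | .T => tentNorm f p
  | .Z => zNorm c f p

/-- The space `X^𝐩`: all `f ∈ L⁰` with finite quasi-norm. -/
def Scale.space (n : ℕ) (F : Type*) [NormedAddCommGroup F] [NormedSpace ℝ F]
    (X : Scale) (c : Whitney) (p : Exponent) : Set (L0 n F) :=
  {f | X.qnorm c p f < ∞}

end

end FractionalData

/-! Everything is expressed through `g = |f|²` and squared quasi-norms, so a finite exponent `(p,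
s)` becomes `P = p / 2`, `σ = 2 * s`, and a bound is a number `M` with `0 < M < ∞`; both
restrictions let powers of `M`, possibly negative, be combined freely.

Finite source. Both scales give one piece of information (`MaxBound`): the Whitney averages of `g`,
weighted by `t ^ (-σ)`, are dominated nontangentially by a function `S` with `L^P` quasi-norm at
most a multiple of `M`. Averaging this over a ball of radius comparable to `t` gives the pointwise
bound with weight `t ^ (-(σ - n/P))`. On the vertical line over `x` the averages weighted for the
target integrability `Q > P` are then bounded by `t ^ (n/P - n/Q) * S x` and by `t ^ (-n/Q) * M`.
Splitting the `dt/t` integral where the two bounds cross (a Hedberg argument) bounds it by a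
multiple of `S x ^ (r * P/Q) * M ^ (r * (1 - P/Q))`. The choice `r = Q`, integrated in `x`, gives
the `Z`-target; `r = 1`, raised to the power `Q`, gives the tent target, since a cone integral is
controlled by a vertical integral of Whitney averages. For infinite targets the pointwise bound is
the `Z`-estimate, and the Carleson estimate follows by using both bounds below height `r`.

Whitney parameters. A Whitney average is controlled by averages with other parameters at points that
may be selected from any sets of proportional measure (`whit_le_of_exists_le`). This gives a reverse
Hölder inequality for every `P > 0`, and the independence of the parameters. A tent source yields
the maximal bound only for small Whitney regions, so it is routed through a `Z`-space of
intermediate integrability; no change of aperture in tent spaces is needed.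

Infinite source. The target must be infinite as well, and distinctness of the exponents forces its
`α` to be positive. Then the pointwise bound leaves the integrable weight `t ^ (2 * α - 1)` in the
Carleson integral. -/

namespace FractionalData

noncomputable section

/-! ### Power weights and a one-dimensional Hedberg inequality -/

/-- The power weight `t ↦ t ^ a` with values in `[0, ∞]`. -/
def wt (a t : ℝ) : ℝ≥0∞ := ENNReal.ofReal t ^ a

lemma wt_ne_zero (a : ℝ) {t : ℝ} (ht : 0 < t) : wt a t ≠ 0 := by
  unfold wt
  rw [ENNReal.ofReal_rpow_of_pos ht]
  exact (ENNReal.ofReal_pos.2 (Real.rpow_pos_of_pos ht a)).ne'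

lemma wt_ne_top (a : ℝ) {t : ℝ} (ht : 0 < t) : wt a t ≠ ∞ := by
  unfold wt
  rw [ENNReal.ofReal_rpow_of_pos ht]
  exact ENNReal.ofReal_ne_top

lemma wt_eq_ofReal (a : ℝ) {t : ℝ} (ht : 0 < t) : wt a t = ENNReal.ofReal (t ^ a) :=
  ENNReal.ofReal_rpow_of_pos ht

lemma wt_add (a b : ℝ) {t : ℝ} (ht : 0 < t) : wt (a + b) t = wt a t * wt b t :=
  ENNReal.rpow_add a b (ENNReal.ofReal_pos.2 ht).ne' ENNReal.ofReal_ne_top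

lemma wt_mul_wt {a b c : ℝ} {t : ℝ} (ht : 0 < t) (h : a + b = c) : wt a t * wt b t = wt c t := by
  rw [← h, wt_add a b ht]

@[simp] lemma wt_zero (t : ℝ) : wt 0 t = 1 := by simp [wt]

lemma wt_rpow (a r t : ℝ) : wt a t ^ r = wt (a * r) t := (ENNReal.rpow_mul _ _ _).symm

lemma wt_neg_mul_cancel (a : ℝ) {t : ℝ} (ht : 0 < t) : wt (-a) t * wt a t = 1 := by
  rw [wt_mul_wt ht (neg_add_cancel a), wt_zero]

lemma measurable_wt (a : ℝ) : Measurable (wt a) := by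
  unfold wt; fun_prop

lemma wt_mono {a : ℝ} (ha : 0 ≤ a) {t t' : ℝ} (h : t ≤ t') : wt a t ≤ wt a t' :=
  ENNReal.rpow_le_rpow (ENNReal.ofReal_le_ofReal h) ha

/-- Power weights at comparable points are comparable. -/
lemma wt_le_of_comparable (a : ℝ) {l t t' : ℝ} (hl : 0 < l) (ht : 0 < t) (ht' : 0 < t')
    (h₁ : t ≤ l * t') (h₂ : t' ≤ l * t) : wt a t ≤ wt |a| l * wt a t' := by
  have key : ∀ b, 0 ≤ b → ∀ u v : ℝ, u ≤ l * v → wt b u ≤ wt b l * wt b v := by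
    intro b hb u v huv
    unfold wt
    rw [← ENNReal.mul_rpow_of_nonneg _ _ hb, ← ENNReal.ofReal_mul hl.le]
    exact ENNReal.rpow_le_rpow (ENNReal.ofReal_le_ofReal huv) hb
  rcases le_total 0 a with ha | ha
  · rw [abs_of_nonneg ha]; exact key a ha _ _ h₁
  · rw [abs_of_nonpos ha]
    calc wt a t = wt a t * (wt (-a) t' * wt a t') := by
          rw [wt_neg_mul_cancel a ht', mul_one]
      _ ≤ wt a t * ((wt (-a) l * wt (-a) t) * wt a t') := by
          gcongr; exact key (-a) (by linarith) _ _ h₂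
      _ = (wt (-a) t * wt a t) * (wt (-a) l * wt a t') := by ring
      _ = _ := by rw [wt_neg_mul_cancel a ht, one_mul]

lemma lintegral_wt_Ioc {a r : ℝ} (ha : 0 < a) (hr : 0 < r) :
    ∫⁻ t in Set.Ioc 0 r, wt (a - 1) t = ENNReal.ofReal a⁻¹ * wt a r := by
  have h1 : IntervalIntegrable (fun t : ℝ => t ^ (a - 1)) volume 0 r :=
    intervalIntegral.intervalIntegrable_rpow' (by linarith)
  have h2 : IntegrableOn (fun t : ℝ => t ^ (a - 1)) (Set.Ioc 0 r) :=
    (intervalIntegrable_iff_integrableOn_Ioc_of_le hr.le).1 h1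
  have h3 : ∫⁻ t in Set.Ioc 0 r, wt (a - 1) t
      = ∫⁻ t in Set.Ioc 0 r, ENNReal.ofReal (t ^ (a - 1)) :=
    setLIntegral_congr_fun measurableSet_Ioc fun t ht => wt_eq_ofReal _ ht.1
  rw [h3, ← ofReal_integral_eq_lintegral_ofReal h2, ← intervalIntegral.integral_of_le hr.le,
    integral_rpow (Or.inl (by linarith)), wt_eq_ofReal _ hr,
    ← ENNReal.ofReal_mul (by positivity)]
  · congr 1
    rw [sub_add_cancel, Real.zero_rpow ha.ne']; field_simp; ring
  · filter_upwards [ae_restrict_mem measurableSet_Ioc] with t ht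
    exact Real.rpow_nonneg ht.1.le _

lemma lintegral_wt_Ioi {b T : ℝ} (hb : 0 < b) (hT : 0 < T) :
    ∫⁻ t in Set.Ioi T, wt (-b - 1) t = ENNReal.ofReal b⁻¹ * wt (-b) T := by
  have h2 : IntegrableOn (fun t : ℝ => t ^ (-b - 1)) (Set.Ioi T) :=
    integrableOn_Ioi_rpow_of_lt (by linarith) hT
  have h3 : ∫⁻ t in Set.Ioi T, wt (-b - 1) t
      = ∫⁻ t in Set.Ioi T, ENNReal.ofReal (t ^ (-b - 1)) :=
    setLIntegral_congr_fun measurableSet_Ioi fun t ht => wt_eq_ofReal _ (hT.trans ht)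
  rw [h3, ← ofReal_integral_eq_lintegral_ofReal h2,
    integral_Ioi_rpow_of_lt (by linarith) hT, wt_eq_ofReal _ hT,
    ← ENNReal.ofReal_mul (by positivity)]
  · congr 1
    rw [sub_add_cancel]; field_simp
  · filter_upwards [ae_restrict_mem measurableSet_Ioi] with t ht
    exact Real.rpow_nonneg (hT.trans ht).le _

/-- A Hedberg type inequality: interpolation between two power bounds. -/
lemma lintegral_rpow_le_of_power_bounds {a b r : ℝ} (ha : 0 < a) (hb : 0 < b) (hr : 0 < r) :
    ∃ C : ℝ≥0∞, C ≠ ∞ ∧ ∀ (u : ℝ → ℝ≥0∞) (S M : ℝ≥0∞), M ≠ 0 → M ≠ ∞ →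
      (∀ t, 0 < t → u t ≤ wt a t * S) → (∀ t, 0 < t → u t ≤ wt (-b) t * M) →
      ∫⁻ t in Set.Ioi 0, u t ^ r * wt (-1) t
        ≤ C * (S ^ (r * (b / (a + b))) * M ^ (r * (a / (a + b)))) := by
  have hab : 0 < a + b := by positivity
  refine ⟨ENNReal.ofReal (a * r)⁻¹ + ENNReal.ofReal (b * r)⁻¹, by simp, ?_⟩
  intro u S M hM0 hMt h1 h2
  rcases eq_or_ne S 0 with rfl | hS0
  · have : ∫⁻ t in Set.Ioi 0, u t ^ r * wt (-1) t = ∫⁻ t in Set.Ioi (0 : ℝ), 0 := by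
      refine setLIntegral_congr_fun measurableSet_Ioi fun t ht => ?_
      have : u t = 0 := by simpa using h1 t ht
      simp [this, hr]
    rw [this]; simp
  rcases eq_or_ne S ∞ with rfl | hSt
  · rw [ENNReal.top_rpow_of_pos (by positivity), ENNReal.top_mul, ENNReal.mul_top]
    · exact le_top
    · have : 0 < ENNReal.ofReal (a * r)⁻¹ := ENNReal.ofReal_pos.2 (by positivity)
      exact (this.trans_le le_self_add).ne'
    · exact (ENNReal.rpow_pos (pos_iff_ne_zero.2 hM0) hMt).ne'
  -- The crossing height of the two bounds: `T ^ a * S = T ^ (-b) * M`. Below it the `S`-bound is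
  -- integrated, above it the `M`-bound.
  set T : ℝ := ((M / S) ^ (1 / (a + b))).toReal with hT
  have hMS0 : M / S ≠ 0 := by simp [ENNReal.div_eq_zero_iff, hM0, hSt]
  have hMSt : M / S ≠ ∞ := by simp [ENNReal.div_eq_top, hM0, hS0, hMt]
  have hX0 : (M / S) ^ (1 / (a + b)) ≠ 0 := (ENNReal.rpow_pos (pos_iff_ne_zero.2 hMS0) hMSt).ne'
  have hXt : (M / S) ^ (1 / (a + b)) ≠ ∞ := ENNReal.rpow_ne_top_of_nonneg (by positivity) hMSt
  have hTpos : 0 < T := ENNReal.toReal_pos hX0 hXt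
  have hwtT : ∀ e, wt e T = M ^ (e / (a + b)) * S ^ (-(e / (a + b))) := by
    intro e
    rw [wt, hT, ENNReal.ofReal_toReal hXt, ← ENNReal.rpow_mul,
      show 1 / (a + b) * e = e / (a + b) by ring, ENNReal.div_eq_inv_mul,
      ENNReal.mul_rpow_of_ne_top (ENNReal.inv_ne_top.2 hS0) hMt, ENNReal.inv_rpow,
      ENNReal.rpow_neg, mul_comm]
  have hsplit : Set.Ioi (0 : ℝ) = Set.Ioc 0 T ∪ Set.Ioi T := (Set.Ioc_union_Ioi_eq_Ioi hTpos.le).symm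
  have e1 : ∫⁻ t in Set.Ioc 0 T, u t ^ r * wt (-1) t
      ≤ ENNReal.ofReal (a * r)⁻¹ * (S ^ (r * (b / (a + b))) * M ^ (r * (a / (a + b)))) := by
    calc ∫⁻ t in Set.Ioc 0 T, u t ^ r * wt (-1) t
        ≤ ∫⁻ t in Set.Ioc 0 T, S ^ r * wt (a * r - 1) t := by
          refine setLIntegral_mono' measurableSet_Ioc fun t ht => ?_
          calc u t ^ r * wt (-1) t ≤ (wt a t * S) ^ r * wt (-1) t := by
                gcongr; exact h1 t ht.1
            _ = S ^ r * wt (a * r - 1) t := by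
                rw [ENNReal.mul_rpow_of_nonneg _ _ hr.le, wt_rpow, sub_eq_add_neg, wt_add _ _ ht.1]
                ring
      _ = S ^ r * (ENNReal.ofReal (a * r)⁻¹ * wt (a * r) T) := by
          rw [lintegral_const_mul _ (measurable_wt _), lintegral_wt_Ioc (by positivity) hTpos]
      _ = ENNReal.ofReal (a * r)⁻¹ * ((S ^ r * S ^ (-(a * r / (a + b)))) * M ^ (a * r / (a + b))) := by
          rw [hwtT]; ring
      _ = _ := by
          rw [← ENNReal.rpow_add _ _ hS0 hSt]
          congr 4 <;> · field_simp; try ring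
  have e2 : ∫⁻ t in Set.Ioi T, u t ^ r * wt (-1) t
      ≤ ENNReal.ofReal (b * r)⁻¹ * (S ^ (r * (b / (a + b))) * M ^ (r * (a / (a + b)))) := by
    calc ∫⁻ t in Set.Ioi T, u t ^ r * wt (-1) t
        ≤ ∫⁻ t in Set.Ioi T, M ^ r * wt (-(b * r) - 1) t := by
          refine setLIntegral_mono' measurableSet_Ioi fun t ht => ?_
          have ht0 : 0 < t := hTpos.trans ht
          calc u t ^ r * wt (-1) t ≤ (wt (-b) t * M) ^ r * wt (-1) t := by
                gcongr; exact h2 t ht0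
            _ = M ^ r * wt (-(b * r) - 1) t := by
                rw [ENNReal.mul_rpow_of_nonneg _ _ hr.le, wt_rpow, sub_eq_add_neg, wt_add _ _ ht0,
                  neg_mul]
                ring
      _ = M ^ r * (ENNReal.ofReal (b * r)⁻¹ * wt (-(b * r)) T) := by
          rw [lintegral_const_mul _ (measurable_wt _), lintegral_wt_Ioi (by positivity) hTpos]
      _ = ENNReal.ofReal (b * r)⁻¹ *
            (S ^ (-(-(b * r) / (a + b))) * (M ^ r * M ^ (-(b * r) / (a + b)))) := by
          rw [hwtT]; ring
      _ = _ := by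
          rw [← ENNReal.rpow_add _ _ hM0 hMt]
          congr 3 <;> · field_simp; try ring
  rw [hsplit, lintegral_union measurableSet_Ioi
    (Set.disjoint_left.2 fun t h h' => not_lt.2 h.2 h'), add_mul]
  exact add_le_add e1 e2

lemma wt_mul (a : ℝ) {l : ℝ} (hl : 0 < l) (t : ℝ) : wt a (l * t) = wt a l * wt a t := by
  unfold wt
  rw [ENNReal.ofReal_mul hl.le,
    ENNReal.mul_rpow_of_ne_top ENNReal.ofReal_ne_top ENNReal.ofReal_ne_top]

lemma wt_one_exp (t : ℝ) : wt 1 t = ENNReal.ofReal t := by simp [wt]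

/-! ### Integrals over fibres of measurable relations -/

lemma measurable_setLIntegral_fiber {α β : Type*} [MeasurableSpace α] [MeasurableSpace β]
    (ν : Measure β) [SFinite ν] {R : Set (α × β)} (hR : MeasurableSet R) {g : β → ℝ≥0∞}
    (hg : Measurable g) : Measurable fun a => ∫⁻ b in {b | (a, b) ∈ R}, g b ∂ν := by
  have : (fun a => ∫⁻ b in {b | (a, b) ∈ R}, g b ∂ν)
      = fun a => ∫⁻ b, R.indicator (fun z => g z.2) (a, b) ∂ν := by
    funext a
    exact (lintegral_indicator (measurable_prodMk_left hR) _).symm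
  rw [this]
  exact ((hg.comp measurable_snd).indicator hR).lintegral_prod_right'

/-- Tonelli's theorem for integrals over the fibres of a measurable relation. -/
lemma lintegral_setLIntegral_fiber_swap {α β : Type*} [MeasurableSpace α] [MeasurableSpace β]
    (μ : Measure α) (ν : Measure β) [SFinite μ] [SFinite ν] {R : Set (α × β)}
    (hR : MeasurableSet R) {G : α × β → ℝ≥0∞} (hG : Measurable G) :
    ∫⁻ a, ∫⁻ b in {b | (a, b) ∈ R}, G (a, b) ∂ν ∂μ
      = ∫⁻ b, ∫⁻ a in {a | (a, b) ∈ R}, G (a, b) ∂μ ∂ν := by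
  have h1 : ∀ a, ∫⁻ b in {b | (a, b) ∈ R}, G (a, b) ∂ν = ∫⁻ b, R.indicator G (a, b) ∂ν := by
    intro a
    exact (lintegral_indicator (measurable_prodMk_left hR) _).symm
  have h2 : ∀ b, ∫⁻ a in {a | (a, b) ∈ R}, G (a, b) ∂μ = ∫⁻ a, R.indicator G (a, b) ∂μ := by
    intro b
    exact (lintegral_indicator (measurable_prodMk_right hR) _).symm
  simp only [h1, h2]
  exact lintegral_lintegral_swap (f := fun a b => R.indicator G (a, b)) (hG.indicator hR).aemeasurable

/-! ### Whitney regions, Whitney averages and change of parameters -/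

variable {n : ℕ}

/-- The volume of the Euclidean unit ball. -/
def unitBallVolume (n : ℕ) : ℝ≥0∞ := volume (Metric.ball (0 : EuclideanSpace ℝ (Fin n)) 1)

lemma unitBallVolume_ne_zero : unitBallVolume n ≠ 0 :=
  (Metric.measure_ball_pos volume _ one_pos).ne'

lemma unitBallVolume_ne_top : unitBallVolume n ≠ ∞ := measure_ball_lt_top.ne

lemma volume_ball_eq_wt (x : EuclideanSpace ℝ (Fin n)) {r : ℝ} (hr : 0 < r) :
    volume (Metric.ball x r) = unitBallVolume n * wt n r := by
  rw [Measure.addHaar_ball_of_pos volume x hr, mul_comm, wt_eq_ofReal _ hr, unitBallVolume]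
  simp

lemma Whitney.c₁_pos (c : Whitney) : 0 < c.c₁ := one_pos.trans c.one_lt_c₁

lemma Whitney.isOpen_region (c : Whitney) (z : Space n) : IsOpen (c.region z) :=
  isOpen_Ioo.prod Metric.isOpen_ball

lemma Whitney.mem_region {c : Whitney} {z w : Space n} : w ∈ c.region z ↔
    (c.c₁⁻¹ * z.1 < w.1 ∧ w.1 < c.c₁ * z.1) ∧ dist w.2 z.2 < c.c₀ * z.1 := by
  simp [Whitney.region, Set.mem_prod]

lemma Whitney.pos_of_mem_region {c : Whitney} {z w : Space n} (hz : 0 < z.1)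
    (h : w ∈ c.region z) : 0 < w.1 :=
  lt_trans (mul_pos (inv_pos.2 c.c₁_pos) hz) (mem_region.1 h).1.1

lemma Whitney.lt_mul_of_mem_region {c : Whitney} {z w : Space n}
    (h : w ∈ c.region z) : z.1 < c.c₁ * w.1 := by
  have := (mem_region.1 h).1.1
  rwa [inv_mul_lt_iff₀ c.c₁_pos] at this

lemma Whitney.volume_region (c : Whitney) : ∃ κ : ℝ≥0∞, κ ≠ 0 ∧ κ ≠ ∞ ∧
    ∀ z : Space n, 0 < z.1 → volume (c.region z) = κ * wt (n + 1) z.1 := by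
  have h1 := c.c₁_pos
  have h2 : c.c₁⁻¹ < c.c₁ := (inv_lt_one_of_one_lt₀ c.one_lt_c₁).trans c.one_lt_c₁
  refine ⟨ENNReal.ofReal (c.c₁ - c.c₁⁻¹) * (unitBallVolume n * wt n c.c₀), ?_, ?_, ?_⟩
  · exact mul_ne_zero (ENNReal.ofReal_pos.2 (sub_pos.2 h2)).ne'
      (mul_ne_zero unitBallVolume_ne_zero (wt_ne_zero _ c.c₀_pos))
  · exact ENNReal.mul_ne_top ENNReal.ofReal_ne_top
      (ENNReal.mul_ne_top unitBallVolume_ne_top (wt_ne_top _ c.c₀_pos))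
  · intro z hz
    rw [Whitney.region, Measure.volume_eq_prod, Measure.prod_prod, Real.volume_Ioo,
      volume_ball_eq_wt _ (mul_pos c.c₀_pos hz), wt_mul _ c.c₀_pos, ← sub_mul,
      ENNReal.ofReal_mul (sub_nonneg.2 h2.le), wt_add _ _ hz, wt_one_exp]
    ring

/-- The normalised mass of `g` on Whitney regions. -/
def whit (c : Whitney) (g : Space n → ℝ≥0∞) (z : Space n) : ℝ≥0∞ :=
  wt (-(n + 1)) z.1 * ∫⁻ w in c.region z, g w

lemma setLIntegral_region_eq (c : Whitney) (g : Space n → ℝ≥0∞) {z : Space n} (hz : 0 < z.1) :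
    ∫⁻ w in c.region z, g w = wt (n + 1) z.1 * whit c g z := by
  rw [whit, ← mul_assoc, wt_mul_wt hz (add_neg_cancel _), wt_zero, one_mul]

lemma measurableSet_region_rel (c : Whitney) :
    MeasurableSet {q : Space n × Space n | q.2 ∈ c.region q.1} := by
  simp only [Whitney.mem_region]
  exact ((measurableSet_lt (f := fun q : Space n × Space n => c.c₁⁻¹ * q.1.1) (by fun_prop)
      (by fun_prop)).inter
    (measurableSet_lt (f := fun q : Space n × Space n => q.2.1) (by fun_prop) (by fun_prop))).inter
    (measurableSet_lt (f := fun q : Space n × Space n => dist q.2.2 q.1.2) (by fun_prop)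
      (by fun_prop))

lemma measurable_whit (c : Whitney) {g : Space n → ℝ≥0∞} (hg : Measurable g) :
    Measurable (whit c g) :=
  ((measurable_wt _).comp measurable_fst).mul
    (measurable_setLIntegral_fiber volume (measurableSet_region_rel c) hg)

/-- Two steps of ratio `√c₁` compose to the ratio `c₁`. Hence the `c`-average at any point of a
small region controls the mass of that whole region, whichever point is taken. -/
lemma Whitney.exists_refinement (c : Whitney) : ∃ c' : Whitney, ∀ z w : Space n, 0 < z.1 →
    w ∈ c'.region z → c'.region z ⊆ c.region w := by
  have h1 := c.c₁_pos
  have hs : 1 < √c.c₁ := by rw [Real.lt_sqrt (by norm_num)]; simpa using c.one_lt_c₁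
  have hs0 : 0 < √c.c₁ := one_pos.trans hs
  have hss : √c.c₁ * √c.c₁ = c.c₁ := Real.mul_self_sqrt h1.le
  refine ⟨⟨c.c₀ / (2 * √c.c₁), √c.c₁, div_pos c.c₀_pos (by positivity), hs⟩, ?_⟩
  intro z w hz hw v hv
  have hw' := Whitney.lt_mul_of_mem_region hw
  have hv' := Whitney.lt_mul_of_mem_region hv
  rw [Whitney.mem_region] at hw hv ⊢
  simp only at hw hv hw' hv' ⊢
  refine ⟨⟨?_, ?_⟩, ?_⟩
  · rw [inv_mul_lt_iff₀ h1]
    nlinarith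
  · nlinarith
  · have e : c.c₀ / (2 * √c.c₁) * z.1 ≤ c.c₀ / 2 * w.1 := by
      rw [div_mul_eq_mul_div, div_le_iff₀ (by positivity)]
      have := c.c₀_pos
      nlinarith
    have := dist_triangle_right v.2 w.2 z.2
    linarith

/-- Whitney averages with arbitrary parameters are controlled by the values of Whitney averages
with other parameters at points chosen in sets of proportional measure. -/
lemma whit_le_of_exists_le (c d : Whitney) : ∃ e : Whitney, ∃ C : ℝ≥0∞, C ≠ 0 ∧ C ≠ ∞ ∧
    ∀ (g : Space n → ℝ≥0∞) (z : Space n), 0 < z.1 → ∀ R : ℝ≥0∞,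
      (∀ U ⊆ e.region z, MeasurableSet U → C⁻¹ * wt (n + 1) z.1 ≤ volume U →
        ∃ w ∈ U, whit c g w ≤ R) → whit d g z ≤ C * R := by
  obtain ⟨c', hc'⟩ := c.exists_refinement (n := n)
  obtain ⟨κ, hκ0, hκt, hκ⟩ := c'.volume_region (n := n)
  have hd1 := d.c₁_pos
  have hd1i := inv_pos.2 hd1
  -- `K` contains the `d`-region of the point `(1, 0)`. A finite cover of `K` by `c'`-regions,
  -- transported by the dilation and translation `sc`, covers `d.region z` with a number of pieces
  -- independent of `z`.
  let K : Set (Space n) := Set.Icc d.c₁⁻¹ d.c₁ ×ˢ Metric.closedBall 0 d.c₀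
  have hK : IsCompact K := isCompact_Icc.prod (isCompact_closedBall _ _)
  have hKpos : ∀ ζ ∈ K, 0 < ζ.1 := fun ζ hζ => hd1i.trans_le hζ.1.1
  obtain ⟨s, hsK, hs⟩ := hK.elim_nhds_subcover c'.region fun ζ hζ => by
    refine (c'.isOpen_region ζ).mem_nhds ?_
    have := hKpos ζ hζ
    rw [Whitney.mem_region, dist_self]
    exact ⟨⟨(inv_mul_lt_iff₀ c'.c₁_pos).2 (lt_mul_of_one_lt_left this c'.one_lt_c₁),
      lt_mul_of_one_lt_left this c'.one_lt_c₁⟩, mul_pos c'.c₀_pos this⟩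
  -- Large enough that `e.region z` contains every piece of the transported cover.
  let e : Whitney := ⟨c'.c₀ * d.c₁ + d.c₀, d.c₁ * c'.c₁,
    add_pos (mul_pos c'.c₀_pos hd1) d.c₀_pos, one_lt_mul_of_lt_of_le d.one_lt_c₁ c'.one_lt_c₁.le⟩
  have hκ' : κ * wt (n + 1) d.c₁⁻¹ ≠ 0 := mul_ne_zero hκ0 (wt_ne_zero _ hd1i)
  have hκ'' : κ * wt (n + 1) d.c₁⁻¹ ≠ ∞ := ENNReal.mul_ne_top hκt (wt_ne_top _ hd1i)
  have he1 : 0 < d.c₁ * c'.c₁ := mul_pos hd1 c'.c₁_pos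
  -- The first summand ensures that each piece has the required proportion of measure; the second
  -- counts the pieces and compares `wt (n + 1)` at the selected point with its value at `z`.
  refine ⟨e, (κ * wt (n + 1) d.c₁⁻¹)⁻¹ + s.card * wt (n + 1) (d.c₁ * c'.c₁), ?_, ?_, ?_⟩
  · simp [hκ'']
  · exact ENNReal.add_ne_top.2 ⟨ENNReal.inv_ne_top.2 hκ',
      ENNReal.mul_ne_top (ENNReal.natCast_ne_top _) (wt_ne_top _ he1)⟩
  intro g z hz R hR
  let sc : Space n → Space n := fun ζ => (z.1 * ζ.1, z.2 + z.1 • ζ.2)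
  have hcover : d.region z ⊆ ⋃ ζ ∈ s, c'.region (sc ζ) := by
    intro w hw
    rw [Whitney.mem_region] at hw
    have hmem : ((z.1⁻¹ * w.1, z.1⁻¹ • (w.2 - z.2)) : Space n) ∈ K := by
      refine ⟨⟨?_, ?_⟩, ?_⟩
      · simp only
        rw [le_inv_mul_iff₀ hz]; linarith [hw.1.1]
      · simp only
        rw [inv_mul_le_iff₀ hz]; linarith [hw.1.2]
      · rw [mem_closedBall_zero_iff, norm_smul, norm_inv, Real.norm_of_nonneg hz.le,
          inv_mul_le_iff₀ hz, ← dist_eq_norm]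
        linarith [hw.2]
    obtain ⟨ζ, hζs, hζ⟩ := Set.mem_iUnion₂.1 (hs hmem)
    refine Set.mem_iUnion₂.2 ⟨ζ, hζs, ?_⟩
    rw [Whitney.mem_region] at hζ ⊢
    simp only [sc] at hζ ⊢
    refine ⟨⟨?_, ?_⟩, ?_⟩
    · have := hζ.1.1
      rw [lt_inv_mul_iff₀ hz] at this; linarith
    · have := hζ.1.2
      rw [inv_mul_lt_iff₀ hz] at this; linarith
    · have := hζ.2
      have hE : w.2 - (z.2 + z.1 • ζ.2) = z.1 • (z.1⁻¹ • (w.2 - z.2) - ζ.2) := by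
        rw [smul_sub, smul_inv_smul₀ hz.ne']; abel
      rw [dist_eq_norm, hE, norm_smul, Real.norm_of_nonneg hz.le, ← dist_eq_norm]
      nlinarith
  have hpiece : ∀ ζ ∈ s, ∫⁻ w in c'.region (sc ζ), g w
      ≤ wt (n + 1) (d.c₁ * c'.c₁) * wt (n + 1) z.1 * R := by
    intro ζ hζ
    have hζK := hsK ζ hζ
    have hζ0 := hKpos ζ hζK
    have hsc : 0 < (sc ζ).1 := mul_pos hz hζ0
    have hsub : c'.region (sc ζ) ⊆ e.region z := by
      intro w hw
      have hwm := Whitney.lt_mul_of_mem_region hw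
      rw [Whitney.mem_region] at hw ⊢
      simp only [sc, e] at hw hwm ⊢
      have hc1 := c'.c₁_pos
      have h1 := hζK.1.1
      have h2 := hζK.1.2
      have h3 : ‖ζ.2‖ ≤ d.c₀ := mem_closedBall_zero_iff.1 hζK.2
      refine ⟨⟨?_, ?_⟩, ?_⟩
      · rw [inv_mul_lt_iff₀ he1, mul_assoc, ← inv_mul_lt_iff₀ hd1]
        nlinarith
      · nlinarith [mul_pos hc1 hz, mul_le_mul_of_nonneg_left h2 (mul_pos hc1 hz).le]
      · have h4 : dist (z.2 + z.1 • ζ.2) z.2 ≤ z.1 * d.c₀ := by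
          rw [dist_eq_norm, add_sub_cancel_left, norm_smul, Real.norm_of_nonneg hz.le]
          gcongr
        have h5 := dist_triangle w.2 (z.2 + z.1 • ζ.2) z.2
        have h6 : c'.c₀ * (z.1 * ζ.1) ≤ c'.c₀ * (z.1 * d.c₁) := by
          have := c'.c₀_pos.le
          gcongr
        nlinarith [hw.2]
    -- The hypothesis is used with `U` a whole piece; by the refinement property the piece then lies
    -- in `c.region w`.
    obtain ⟨w, hw, hwR⟩ := hR _ hsub (c'.isOpen_region _).measurableSet (by
      rw [hκ _ hsc]
      calc ((κ * wt (n + 1) d.c₁⁻¹)⁻¹ + s.card * wt (n + 1) (d.c₁ * c'.c₁))⁻¹ * wt (n + 1) z.1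
          ≤ (κ * wt (n + 1) d.c₁⁻¹)⁻¹⁻¹ * wt (n + 1) z.1 := by
            gcongr; exact le_self_add
        _ = κ * wt (n + 1) (d.c₁⁻¹ * z.1) := by rw [inv_inv, wt_mul _ hd1i, mul_assoc]
        _ ≤ κ * wt (n + 1) (sc ζ).1 := by
            gcongr
            refine wt_mono (by positivity) ?_
            simp only [sc]
            rw [mul_comm]
            exact mul_le_mul_of_nonneg_left hζK.1.1 hz.le)
    have hw0 := Whitney.pos_of_mem_region hsc hw
    calc ∫⁻ w in c'.region (sc ζ), g w ≤ ∫⁻ v in c.region w, g v :=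
          lintegral_mono_set (hc' _ _ hsc hw)
      _ = wt (n + 1) w.1 * whit c g w := setLIntegral_region_eq c g hw0
      _ ≤ wt (n + 1) (d.c₁ * c'.c₁ * z.1) * R := by
          gcongr
          exact wt_mono (by positivity) (Whitney.mem_region.1 (hsub hw)).1.2.le
      _ = _ := by rw [wt_mul _ he1]
  calc whit d g z ≤ wt (-(n + 1)) z.1 * ∑ ζ ∈ s, ∫⁻ w in c'.region (sc ζ), g w := by
        unfold whit
        gcongr
        calc ∫⁻ w in d.region z, g w ≤ ∫⁻ w in ⋃ ζ ∈ s, c'.region (sc ζ), g w :=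
              lintegral_mono_set hcover
          _ = ∫⁻ w in ⋃ ζ : s, c'.region (sc ζ), g w := by
              rw [Set.iUnion_subtype]
          _ ≤ ∑' ζ : s, ∫⁻ w in c'.region (sc ζ), g w := lintegral_iUnion_le _ _
          _ = _ := Finset.tsum_subtype s fun ζ => ∫⁻ w in c'.region (sc ζ), g w
    _ ≤ wt (-(n + 1)) z.1 * ∑ ζ ∈ s, wt (n + 1) (d.c₁ * c'.c₁) * wt (n + 1) z.1 * R := by
        gcongr with ζ hζ
        exact hpiece ζ hζ
    _ = (wt (-(n + 1)) z.1 * wt (n + 1) z.1) * (s.card * wt (n + 1) (d.c₁ * c'.c₁)) * R := by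
        rw [Finset.sum_const, nsmul_eq_mul]; ring
    _ ≤ _ := by
        rw [wt_neg_mul_cancel _ hz, one_mul]
        gcongr; exact le_add_self

lemma wt_inv (a t : ℝ) : (wt a t)⁻¹ = wt (-a) t := (ENNReal.rpow_neg _ _).symm

lemma le_rpow_one_div_iff {x y : ℝ≥0∞} {P : ℝ} (hP : 0 < P) : x ≤ y ^ (1 / P) ↔ x ^ P ≤ y := by
  rw [one_div, ENNReal.le_rpow_inv_iff hP]

lemma measurableSet_upperHalf : MeasurableSet (upperHalf n) :=
  measurableSet_lt measurable_const measurable_fst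

lemma setLIntegral_upperHalf {φ : Space n → ℝ≥0∞} (hφ : Measurable φ) :
    ∫⁻ z in upperHalf n, φ z = ∫⁻ x, ∫⁻ t in Set.Ioi (0 : ℝ), φ (t, x) := by
  have h : upperHalf n = Set.Ioi (0 : ℝ) ×ˢ Set.univ := by
    ext z; simp [upperHalf]
  rw [h, Measure.volume_eq_prod, ← Measure.prod_restrict, Measure.restrict_univ,
    lintegral_prod_symm _ hφ.aemeasurable]

lemma Whitney.region_subset_upperHalf (c : Whitney) {z : Space n} (hz : 0 < z.1) :
    c.region z ⊆ upperHalf n := fun _ hw => Whitney.pos_of_mem_region hz hw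

/-- On a Whitney region the power weights are comparable to their value at the centre. -/
lemma Whitney.wt_le_of_mem_region (c : Whitney) (a : ℝ) {z w : Space n} (hz : 0 < z.1)
    (hw : w ∈ c.region z) :
    wt a z.1 ≤ wt |a| c.c₁ * wt a w.1 ∧ wt a w.1 ≤ wt |a| c.c₁ * wt a z.1 := by
  have hw0 := Whitney.pos_of_mem_region hz hw
  have h1 := (Whitney.lt_mul_of_mem_region hw).le
  have h2 := (Whitney.mem_region.1 hw).1.2.le
  exact ⟨wt_le_of_comparable a c.c₁_pos hz hw0 h1 h2, wt_le_of_comparable a c.c₁_pos hw0 hz h2 h1⟩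

/-- A reverse Hölder type inequality for Whitney averages, valid for all exponents. -/
lemma whit_rpow_le (c d : Whitney) {P : ℝ} (hP : 0 < P) : ∃ e : Whitney, ∃ C : ℝ≥0∞, C ≠ ∞ ∧
    ∀ g : Space n → ℝ≥0∞, Measurable g → ∀ z : Space n, 0 < z.1 →
      whit d g z ^ P ≤ C * (wt (-(n + 1)) z.1 * ∫⁻ w in e.region z, whit c g w ^ P) := by
  obtain ⟨e, C, hC0, hCt, h⟩ := whit_le_of_exists_le (n := n) c d
  refine ⟨e, C ^ P * C, ENNReal.mul_ne_top (ENNReal.rpow_ne_top_of_nonneg hP.le hCt) hCt, ?_⟩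
  intro g hg z hz
  set I := wt (-(n + 1)) z.1 * ∫⁻ w in e.region z, whit c g w ^ P with hI
  have key := h g z hz ((C * I) ^ (1 / P)) ?_
  · calc whit d g z ^ P ≤ (C * (C * I) ^ (1 / P)) ^ P := by gcongr
      _ = C ^ P * C * I := by
        rw [ENNReal.mul_rpow_of_nonneg _ _ hP.le, ← ENNReal.rpow_mul, one_div_mul_cancel hP.ne',
          ENNReal.rpow_one, mul_assoc]
  · intro U hU hUm hvol
    obtain ⟨κ, -, hκt, hκ⟩ := e.volume_region (n := n)
    have hw0 := wt_ne_zero ((n : ℝ) + 1) hz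
    have hwt := wt_ne_top ((n : ℝ) + 1) hz
    have hU0 : volume U ≠ 0 :=
      ((pos_iff_ne_zero.2 (mul_ne_zero (ENNReal.inv_ne_zero.2 hCt) hw0)).trans_le hvol).ne'
    have hUt : volume U ≠ ∞ := by
      refine ((measure_mono hU).trans_lt ?_).ne
      rw [hκ z hz]
      exact (ENNReal.mul_ne_top hκt hwt).lt_top
    -- Some point of `U` lies below the average of the `P`-th power over `U`. No convexity enters,
    -- so `P < 1` is allowed.
    obtain ⟨w, hw, hle⟩ := exists_le_setLAverage (f := fun w => whit c g w ^ P) hU0 hUt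
      ((measurable_whit c hg).pow_const P).aemeasurable
    refine ⟨w, hw, (le_rpow_one_div_iff hP).2 (hle.trans ?_)⟩
    rw [setLAverage_eq, ENNReal.div_eq_inv_mul, hI, ← mul_assoc]
    gcongr
    calc (volume U)⁻¹ ≤ (C⁻¹ * wt (n + 1) z.1)⁻¹ := ENNReal.inv_le_inv.2 hvol
      _ = C * wt (-(n + 1)) z.1 := by
        rw [ENNReal.mul_inv (Or.inr hwt) (Or.inr hw0), inv_inv, wt_inv]

/-- An almost everywhere bound for weighted Whitney averages gives an everywhere bound for all
other Whitney parameters. -/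
lemma whit_le_of_ae_le (c d : Whitney) (ρ : ℝ) : ∃ C : ℝ≥0∞, C ≠ 0 ∧ C ≠ ∞ ∧
    ∀ (g : Space n → ℝ≥0∞) (K : ℝ≥0∞),
      (∀ᵐ z ∂(volume : Measure (Space n)).restrict (upperHalf n),
        wt (-ρ) z.1 * whit c g z ≤ K) →
      ∀ z : Space n, 0 < z.1 → wt (-ρ) z.1 * whit d g z ≤ C * K := by
  obtain ⟨e, C, hC0, hCt, h⟩ := whit_le_of_exists_le (n := n) c d
  refine ⟨C * wt |ρ| e.c₁, mul_ne_zero hC0 (wt_ne_zero _ e.c₁_pos),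
    ENNReal.mul_ne_top hCt (wt_ne_top _ e.c₁_pos), ?_⟩
  intro g K hK z hz
  have key := h g z hz (wt |ρ| e.c₁ * wt ρ z.1 * K) ?_
  · calc wt (-ρ) z.1 * whit d g z ≤ wt (-ρ) z.1 * (C * (wt |ρ| e.c₁ * wt ρ z.1 * K)) := by gcongr
      _ = (wt (-ρ) z.1 * wt ρ z.1) * (C * wt |ρ| e.c₁ * K) := by ring
      _ = _ := by rw [wt_neg_mul_cancel _ hz, one_mul]
  · intro U hU hUm hvol
    have hU0 : volume U ≠ 0 :=
      ((pos_iff_ne_zero.2 (mul_ne_zero (ENNReal.inv_ne_zero.2 hCt) (wt_ne_zero _ hz))).trans_le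
        hvol).ne'
    have hUu : U ⊆ upperHalf n := hU.trans (e.region_subset_upperHalf hz)
    have hK' := ae_restrict_of_ae_restrict_of_subset hUu hK
    -- A set of positive measure cannot avoid the full-measure set on which the bound holds.
    have : ∃ w ∈ U, wt (-ρ) w.1 * whit c g w ≤ K := by
      by_contra! hcon
      have hfalse : ∀ᵐ z ∂(volume : Measure (Space n)).restrict U, False := by
        filter_upwards [hK', ae_restrict_mem hUm] with w h1 h2
        exact absurd h1 (not_le.2 (hcon w h2))
      rw [Filter.eventually_false_iff_eq_bot, ae_eq_bot, Measure.restrict_eq_zero] at hfalse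
      exact hU0 hfalse
    obtain ⟨w, hw, hwK⟩ := this
    have hw0 : 0 < w.1 := hUu hw
    refine ⟨w, hw, ?_⟩
    calc whit c g w = wt ρ w.1 * (wt (-ρ) w.1 * whit c g w) := by
          rw [← mul_assoc, wt_mul_wt hw0 (add_neg_cancel ρ), wt_zero, one_mul]
      _ ≤ (wt |ρ| e.c₁ * wt ρ z.1) * K := by
          gcongr
          exact (e.wt_le_of_mem_region ρ hz (hU hw)).2

/-! ### Bounds for squared quasi-norms and implications between them -/

/-- `M` bounds the squared `Z`-norm of a function with squared modulus `g`, finite exponents. -/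
def ZBound (P σ : ℝ) (c : Whitney) (g : Space n → ℝ≥0∞) (M : ℝ≥0∞) : Prop :=
  ∫⁻ z in upperHalf n, (wt (-σ) z.1 * whit c g z) ^ P * wt (-1) z.1 ≤ M ^ P

/-- `M` bounds the squared tent space norm of a function with squared modulus `g`, finite
exponents. -/
def TBound (P σ : ℝ) (g : Space n → ℝ≥0∞) (M : ℝ≥0∞) : Prop :=
  ∫⁻ x, (∫⁻ z in cone x, wt (-(σ + (n + 1))) z.1 * g z) ^ P ≤ M ^ P

/-- `M` bounds the squared `Z`-norm, infinite exponents. -/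
def ZBoundTop (ρ : ℝ) (c : Whitney) (g : Space n → ℝ≥0∞) (M : ℝ≥0∞) : Prop :=
  ∀ z : Space n, 0 < z.1 → wt (-ρ) z.1 * whit c g z ≤ M

/-- `M` bounds the squared weighted Carleson norm, infinite exponents. -/
def TBoundTop (A σ : ℝ) (g : Space n → ℝ≥0∞) (M : ℝ≥0∞) : Prop :=
  ∀ (x : EuclideanSpace ℝ (Fin n)) (r : ℝ), 0 < r →
    ∫⁻ z in tent x r, wt (-(σ + 1)) z.1 * g z ≤ M * wt (n + A) r

/-- The weighted Whitney averages are dominated, nontangentially, by a function whose `L^P`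
quasi-norm is at most `M`. -/
def MaxBound (P σ : ℝ) (d : Whitney) (g : Space n → ℝ≥0∞) (M : ℝ≥0∞) : Prop :=
  ∃ S : EuclideanSpace ℝ (Fin n) → ℝ≥0∞, Measurable S ∧ ∫⁻ y, S y ^ P ≤ M ^ P ∧
    ∀ z : Space n, 0 < z.1 → ∀ y, dist y z.2 < z.1 / 4 → wt (-σ) z.1 * whit d g z ≤ S y

/-- `Φ`-bounds imply `Ψ`-bounds, up to a multiplicative constant. -/
def Controls (Φ Ψ : (Space n → ℝ≥0∞) → ℝ≥0∞ → Prop) : Prop :=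
  ∃ C : ℝ≥0∞, C ≠ 0 ∧ C ≠ ∞ ∧ ∀ g : Space n → ℝ≥0∞, Measurable g → ∀ M : ℝ≥0∞, M ≠ 0 → M ≠ ∞ →
    Φ g M → Ψ g (C * M)

lemma Controls.trans {Φ Ψ Θ : (Space n → ℝ≥0∞) → ℝ≥0∞ → Prop} (h₁ : Controls Φ Ψ)
    (h₂ : Controls Ψ Θ) : Controls Φ Θ := by
  obtain ⟨C₁, h10, h1t, h1⟩ := h₁
  obtain ⟨C₂, h20, h2t, h2⟩ := h₂
  refine ⟨C₂ * C₁, mul_ne_zero h20 h10, ENNReal.mul_ne_top h2t h1t, fun g hg M hM0 hMt h => ?_⟩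
  rw [mul_assoc]
  exact h2 g hg _ (mul_ne_zero h10 hM0) (ENNReal.mul_ne_top h1t hMt) (h1 g hg M hM0 hMt h)

/-! ### The maximal bound from both scales -/

lemma measurableSet_cone_rel (A : ℝ) :
    MeasurableSet {q : EuclideanSpace ℝ (Fin n) × Space n | dist q.2.2 q.1 < A * q.2.1} :=
  measurableSet_lt (by fun_prop) (by fun_prop)

lemma measurableSet_cone_fiber (A : ℝ) (x : EuclideanSpace ℝ (Fin n)) :
    MeasurableSet {z : Space n | dist z.2 x < A * z.1} :=
  measurable_prodMk_left (measurableSet_cone_rel (n := n) A)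

lemma setLIntegral_cone (x : EuclideanSpace ℝ (Fin n)) (φ : Space n → ℝ≥0∞) :
    ∫⁻ z in cone x, φ z = ∫⁻ z in {z : Space n | dist z.2 x < 1 * z.1}, φ z
      ∂((volume : Measure (Space n)).restrict (upperHalf n)) := by
  rw [Measure.restrict_restrict (measurableSet_cone_fiber 1 x)]
  congr 2
  ext z
  simp [cone, upperHalf, and_comm]

lemma measurable_setLIntegral_cone {φ : Space n → ℝ≥0∞} (hφ : Measurable φ) :
    Measurable fun x => ∫⁻ z in cone x, φ z := by
  simp only [setLIntegral_cone]
  exact measurable_setLIntegral_fiber _ (measurableSet_cone_rel 1) hφ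

/-- The Whitney parameters whose regions lie in the cones with nearby vertices. -/
def smallWhitney : Whitney := ⟨1 / 4, 2, by norm_num, by norm_num⟩

/-- A small Whitney region around `z` lies in the cone over every vertex `y` within `z.1 / 4` of
`z.2`, so a multiple of the squared conical function serves as `S`. -/
lemma controls_TBound_MaxBound {P : ℝ} (hP : 0 < P) (σ : ℝ) :
    Controls (n := n) (TBound P σ) (MaxBound P σ smallWhitney) := by
  refine ⟨wt |-(σ + (n + 1))| 2, wt_ne_zero _ two_pos, wt_ne_top _ two_pos, ?_⟩
  intro g hg M _ _ hM
  set C := wt |-(σ + (n + 1))| 2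
  have hφ : Measurable fun z : Space n => wt (-(σ + (n + 1))) z.1 * g z :=
    ((measurable_wt _).comp measurable_fst).mul hg
  refine ⟨fun y => C * ∫⁻ z in cone y, wt (-(σ + (n + 1))) z.1 * g z,
    (measurable_setLIntegral_cone hφ).const_mul C, ?_, ?_⟩
  · simp only [ENNReal.mul_rpow_of_nonneg _ _ hP.le]
    rw [lintegral_const_mul _ ((measurable_setLIntegral_cone hφ).pow_const P)]
    gcongr
    exact hM
  · intro z hz y hy
    calc wt (-σ) z.1 * whit smallWhitney g z
        = wt (-(σ + (n + 1))) z.1 * ∫⁻ w in smallWhitney.region z, g w := by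
          rw [whit, ← mul_assoc, wt_mul_wt hz (c := -(σ + (n + 1))) (by ring)]
      _ = ∫⁻ w in smallWhitney.region z, wt (-(σ + (n + 1))) z.1 * g w := by
          rw [lintegral_const_mul _ hg]
      _ ≤ ∫⁻ w in smallWhitney.region z, C * (wt (-(σ + (n + 1))) w.1 * g w) := by
          refine setLIntegral_mono' (Whitney.isOpen_region _ _).measurableSet fun w hw => ?_
          rw [← mul_assoc]
          gcongr
          exact (smallWhitney.wt_le_of_mem_region _ hz hw).1
      _ = C * ∫⁻ w in smallWhitney.region z, wt (-(σ + (n + 1))) w.1 * g w := by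
          rw [lintegral_const_mul _ hφ]
      _ ≤ _ := by
          refine mul_le_mul_right (lintegral_mono_set fun w hw => ?_) _
          have h0 := Whitney.pos_of_mem_region hz hw
          have h1 := Whitney.lt_mul_of_mem_region hw
          rw [Whitney.mem_region] at hw
          simp only [smallWhitney] at hw h1
          refine ⟨h0, ?_⟩
          -- The two distances add up to less than `z.1 / 4 + z.1 / 4 = z.1 / 2`, which is below
          -- `w.1`.
          have := dist_triangle_right w.2 y z.2
          linarith [hw.2]

/-- Take `S ^ P` to be a multiple of the conical integral of the `P`-th powers of Whitney averages.
The reverse Hölder inequality gives the domination, and Tonelli in the vertex turns the integral of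
`S ^ P` back into the `Z`-integral. -/
lemma controls_ZBound_MaxBound {P : ℝ} (hP : 0 < P) (σ : ℝ) (c d : Whitney) :
    Controls (n := n) (ZBound P σ c) (MaxBound P σ d) := by
  obtain ⟨e, C₁, hC₁, h⟩ := whit_rpow_le (n := n) c d hP
  -- The summand `n + 1` normalises the reverse Hölder average; integration over vertices restores
  -- `t ^ n`, leaving the weight `t ^ (-σ * P - 1)`.
  set b : ℝ := -(σ * P + (n + 1)) with hb
  -- An aperture for which the cone over `y` contains `e.region z` whenever `y` is within `z.1 / 4`
  -- of `z.2`.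
  set A : ℝ := (e.c₀ + 1) * e.c₁ with hA
  have hApos : 0 < A := mul_pos (add_pos e.c₀_pos one_pos) e.c₁_pos
  set C₂ : ℝ≥0∞ := C₁ * wt |b| e.c₁ with hC₂
  have hC₂t : C₂ ≠ ∞ := ENNReal.mul_ne_top hC₁ (wt_ne_top _ e.c₁_pos)
  set C₃ : ℝ≥0∞ := C₂ * (unitBallVolume n * wt n A) + 1 with hC₃
  have hC₃t : C₃ ≠ ∞ := ENNReal.add_ne_top.2 ⟨ENNReal.mul_ne_top hC₂t
    (ENNReal.mul_ne_top unitBallVolume_ne_top (wt_ne_top _ hApos)), ENNReal.one_ne_top⟩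
  have hC₃0 : C₃ ≠ 0 := by simp [hC₃]
  refine ⟨C₃ ^ (1 / P), (ENNReal.rpow_pos (pos_iff_ne_zero.2 hC₃0) hC₃t).ne',
    ENNReal.rpow_ne_top_of_nonneg (by positivity) hC₃t, ?_⟩
  intro g hg M _ _ hM
  have hφ : Measurable fun w : Space n => wt b w.1 * whit c g w ^ P :=
    ((measurable_wt _).comp measurable_fst).mul ((measurable_whit c hg).pow_const P)
  let J : EuclideanSpace ℝ (Fin n) → ℝ≥0∞ := fun y =>
    ∫⁻ w in {w : Space n | dist w.2 y < A * w.1}, wt b w.1 * whit c g w ^ P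
      ∂((volume : Measure (Space n)).restrict (upperHalf n))
  have hJ : Measurable J := measurable_setLIntegral_fiber _ (measurableSet_cone_rel A) hφ
  refine ⟨fun y => (C₂ * J y) ^ (1 / P), (hJ.const_mul _).pow_const _, ?_, ?_⟩
  · calc ∫⁻ y, ((C₂ * J y) ^ (1 / P)) ^ P = C₂ * ∫⁻ y, J y := by
          simp only [← ENNReal.rpow_mul, one_div_mul_cancel hP.ne', ENNReal.rpow_one]
          rw [lintegral_const_mul _ hJ]
      _ = C₂ * ∫⁻ w in upperHalf n, ∫⁻ _ in {y | dist w.2 y < A * w.1},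
            wt b w.1 * whit c g w ^ P := by
          congr 1
          exact lintegral_setLIntegral_fiber_swap volume _ (measurableSet_cone_rel A)
            (hφ.comp measurable_snd)
      _ = C₂ * ∫⁻ w in upperHalf n, (unitBallVolume n * wt n A) *
            ((wt (-σ) w.1 * whit c g w) ^ P * wt (-1) w.1) := by
          congr 1
          refine setLIntegral_congr_fun measurableSet_upperHalf fun w hw => ?_
          have hw0 : 0 < w.1 := hw
          have hset : {y | dist w.2 y < A * w.1} = Metric.ball w.2 (A * w.1) := by
            ext y; simp [dist_comm]
          rw [setLIntegral_const, hset, volume_ball_eq_wt _ (mul_pos hApos hw0), wt_mul _ hApos,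
            ENNReal.mul_rpow_of_nonneg _ _ hP.le, wt_rpow]
          calc _ = (wt b w.1 * wt n w.1) * (whit c g w ^ P * (unitBallVolume n * wt n A)) := by ring
            _ = (wt (-σ * P) w.1 * wt (-1) w.1) *
                (whit c g w ^ P * (unitBallVolume n * wt n A)) := by
              rw [← wt_add _ _ hw0, ← wt_add _ _ hw0]
              congr 2
              rw [hb]; ring
            _ = _ := by ring
      _ = C₂ * (unitBallVolume n * wt n A) *
            ∫⁻ w in upperHalf n, (wt (-σ) w.1 * whit c g w) ^ P * wt (-1) w.1 := by
          rw [lintegral_const_mul', ← mul_assoc C₂]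
          exact ENNReal.mul_ne_top unitBallVolume_ne_top (wt_ne_top _ hApos)
      _ ≤ C₃ * M ^ P := by
          gcongr
          · exact le_self_add
          · exact hM
      _ = _ := by
          rw [ENNReal.mul_rpow_of_nonneg _ _ hP.le, ← ENNReal.rpow_mul, one_div_mul_cancel hP.ne',
            ENNReal.rpow_one]
  · intro z hz y hy
    rw [le_rpow_one_div_iff hP]
    have hsub : e.region z ⊆ {w : Space n | dist w.2 y < A * w.1} ∩ upperHalf n := by
      intro w hw
      refine ⟨?_, e.region_subset_upperHalf hz hw⟩
      have h1 := Whitney.lt_mul_of_mem_region hw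
      rw [Whitney.mem_region] at hw
      have h2 := dist_triangle_right w.2 y z.2
      have h3 : (e.c₀ + 1) * z.1 ≤ (e.c₀ + 1) * (e.c₁ * w.1) :=
        mul_le_mul_of_nonneg_left h1.le (add_pos e.c₀_pos one_pos).le
      simp only [Set.mem_ofPred_eq, hA]
      nlinarith [hw.2]
    calc (wt (-σ) z.1 * whit d g z) ^ P
        = wt (-σ * P) z.1 * whit d g z ^ P := by
          rw [ENNReal.mul_rpow_of_nonneg _ _ hP.le, wt_rpow]
      _ ≤ wt (-σ * P) z.1 *
            (C₁ * (wt (-(n + 1)) z.1 * ∫⁻ w in e.region z, whit c g w ^ P)) := by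
          gcongr; exact h g hg z hz
      _ = C₁ * ((wt (-σ * P) z.1 * wt (-(n + 1)) z.1) * ∫⁻ w in e.region z, whit c g w ^ P) := by
          ring
      _ = C₁ * ∫⁻ w in e.region z, wt b z.1 * whit c g w ^ P := by
          rw [wt_mul_wt hz (c := b) (by rw [hb]; ring),
            lintegral_const_mul _ ((measurable_whit c hg).pow_const P)]
      _ ≤ C₁ * ∫⁻ w in e.region z, wt |b| e.c₁ * (wt b w.1 * whit c g w ^ P) := by
          refine mul_le_mul_right ?_ _
          refine setLIntegral_mono' (Whitney.isOpen_region _ _).measurableSet fun w hw => ?_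
          rw [← mul_assoc]
          gcongr
          exact (e.wt_le_of_mem_region _ hz hw).1
      _ = C₂ * ∫⁻ w in e.region z, wt b w.1 * whit c g w ^ P := by
          rw [lintegral_const_mul _ hφ, hC₂, mul_assoc]
      _ ≤ C₂ * J y := by
          gcongr
          simp only [J]
          rw [Measure.restrict_restrict (measurableSet_cone_fiber A y)]
          exact lintegral_mono_set hsub

/-- A maximal bound implies a pointwise bound of the Whitney averages. -/
lemma controls_MaxBound_ZBoundTop {P : ℝ} (hP : 0 < P) (σ : ℝ) (d : Whitney) :
    Controls (n := n) (MaxBound P σ d) (ZBoundTop (σ - n / P) d) := by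
  have h4 : (0 : ℝ) < 4⁻¹ := by norm_num
  set κ := unitBallVolume n * wt n 4⁻¹ with hκ
  have hκ0 : κ ≠ 0 := mul_ne_zero unitBallVolume_ne_zero (wt_ne_zero _ h4)
  have hκt : κ ≠ ∞ := ENNReal.mul_ne_top unitBallVolume_ne_top (wt_ne_top _ h4)
  refine ⟨κ⁻¹ ^ (1 / P), (ENNReal.rpow_pos (ENNReal.inv_pos.2 hκt) (ENNReal.inv_ne_top.2 hκ0)).ne',
    ENNReal.rpow_ne_top_of_nonneg (by positivity) (ENNReal.inv_ne_top.2 hκ0), ?_⟩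
  rintro g hg M _ _ ⟨S, hS, hSM, hSz⟩ z hz
  rw [← ENNReal.rpow_le_rpow_iff hP]
  set a := wt (-σ) z.1 * whit d g z with ha
  -- Every `y` in the ball of radius `z.1 / 4` satisfies `a ≤ S y`; the measure `κ * t ^ n` of that
  -- ball produces the shift `n / P`.
  have h1 : a ^ P * (κ * wt n z.1) ≤ M ^ P := by
    calc a ^ P * (κ * wt n z.1) = ∫⁻ _ in Metric.ball z.2 (4⁻¹ * z.1), a ^ P := by
          rw [setLIntegral_const, volume_ball_eq_wt _ (mul_pos h4 hz), wt_mul _ h4, hκ, mul_assoc]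
      _ ≤ ∫⁻ y in Metric.ball z.2 (4⁻¹ * z.1), S y ^ P := by
          refine setLIntegral_mono' measurableSet_ball fun y hy => ?_
          gcongr
          refine hSz z hz y ?_
          have := Metric.mem_ball.1 hy
          linarith
      _ ≤ ∫⁻ y, S y ^ P := setLIntegral_le_lintegral _ _
      _ ≤ _ := hSM
  calc (wt (-(σ - n / P)) z.1 * whit d g z) ^ P = (wt (n / P) z.1 * a) ^ P := by
        rw [ha, ← mul_assoc, wt_mul_wt hz]; ring
    _ = κ⁻¹ * (a ^ P * (κ * wt n z.1)) := by
        rw [ENNReal.mul_rpow_of_nonneg _ _ hP.le, wt_rpow, div_mul_cancel₀ _ hP.ne']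
        calc _ = (κ⁻¹ * κ) * (a ^ P * wt n z.1) := by
              rw [ENNReal.inv_mul_cancel hκ0 hκt, one_mul, mul_comm]
          _ = _ := by ring
    _ ≤ κ⁻¹ * M ^ P := by gcongr
    _ = _ := by
        rw [ENNReal.mul_rpow_of_nonneg _ _ hP.le, ← ENNReal.rpow_mul, one_div_mul_cancel hP.ne',
          ENNReal.rpow_one]

/-! ### From the maximal bound to finite exponents -/

/-- A maximal bound combined with the pointwise bound it implies. -/
def MaxSupBound (P σ : ℝ) (d : Whitney) (g : Space n → ℝ≥0∞) (M : ℝ≥0∞) : Prop :=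
  ∃ S : EuclideanSpace ℝ (Fin n) → ℝ≥0∞, Measurable S ∧ ∫⁻ y, S y ^ P ≤ M ^ P ∧
    (∀ z : Space n, 0 < z.1 → wt (-σ) z.1 * whit d g z ≤ S z.2) ∧ ZBoundTop (σ - n / P) d g M

/-- The nontangential domination serves only to produce the pointwise bound; afterwards its vertical
case suffices. -/
lemma controls_MaxBound_MaxSupBound {P : ℝ} (hP : 0 < P) (σ : ℝ) (d : Whitney) :
    Controls (n := n) (MaxBound P σ d) (MaxSupBound P σ d) := by
  obtain ⟨C, hC0, hCt, h⟩ := controls_MaxBound_ZBoundTop (n := n) hP σ d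
  refine ⟨C + 1, by simp, by simp [hCt], fun g hg M hM0 hMt hM => ?_⟩
  have h1 := h g hg M hM0 hMt hM
  obtain ⟨S, hS, hSM, hSz⟩ := hM
  refine ⟨S, hS, hSM.trans ?_, fun z hz => hSz z hz _ (by simp [hz]), fun z hz => ?_⟩
  · gcongr
    rw [add_mul, one_mul]; exact le_add_self
  · refine (h1 z hz).trans ?_
    gcongr; exact le_self_add

/-- The Hedberg inequality on the vertical line over `x`, with growth exponent `n/P - n/Q` from the
`S`-bound and decay exponent `n/Q` from the `M`-bound. -/
lemma lintegral_whit_rpow_le (hn : 1 ≤ n) {P Q r : ℝ} (hP : 0 < P) (hPQ : P < Q) (hr : 0 < r)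
    (σ : ℝ) (d : Whitney) : ∃ C : ℝ≥0∞, C ≠ ∞ ∧
      ∀ (g : Space n → ℝ≥0∞) (S : EuclideanSpace ℝ (Fin n) → ℝ≥0∞) (M : ℝ≥0∞), M ≠ 0 → M ≠ ∞ →
      (∀ z : Space n, 0 < z.1 → wt (-σ) z.1 * whit d g z ≤ S z.2) →
      ZBoundTop (σ - n / P) d g M → ∀ x,
        ∫⁻ t in Set.Ioi 0, (wt (-(σ - n / P + n / Q)) t * whit d g (t, x)) ^ r * wt (-1) t
          ≤ C * (S x ^ (r * (P / Q)) * M ^ (r * (1 - P / Q))) := by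
  have hn0 : (0 : ℝ) < n := by exact_mod_cast hn
  have hQ : 0 < Q := hP.trans hPQ
  have hb : 0 < n / Q := by positivity
  -- Here the strict inequality `P < Q` is indispensable: without growth the integral near `t = 0`
  -- could diverge.
  have ha : 0 < n / P - n / Q := sub_pos.2 (div_lt_div_of_pos_left hn0 hP hPQ)
  obtain ⟨C, hC, h⟩ := lintegral_rpow_le_of_power_bounds ha hb hr
  refine ⟨C, hC, fun g S M hM0 hMt hS hM x => ?_⟩
  have key := h (fun t => wt (-(σ - n / P + n / Q)) t * whit d g (t, x)) (S x) M hM0 hMt ?_ ?_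
  · have e1 : (n / Q) / (n / P - n / Q + n / Q) = P / Q := by
      rw [sub_add_cancel]; field_simp
    have e2 : (n / P - n / Q) / (n / P - n / Q + n / Q) = 1 - P / Q := by
      rw [sub_add_cancel]; field_simp
    rwa [e1, e2] at key
  · intro t ht
    have := hS (t, x) ht
    calc _ = wt (n / P - n / Q) t * (wt (-σ) t * whit d g (t, x)) := by
          rw [← mul_assoc, wt_mul_wt ht (c := -(σ - n / P + n / Q)) (by ring)]
      _ ≤ _ := by gcongr
  · intro t ht
    have := hM (t, x) ht
    calc _ = wt (-(n / Q)) t * (wt (-(σ - n / P)) t * whit d g (t, x)) := by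
          rw [← mul_assoc, wt_mul_wt ht (c := -(σ - n / P + n / Q)) (by ring)]
      _ ≤ _ := by gcongr

/-- With `r = Q` the vertical integral is at most a multiple of `S x ^ P * M ^ (Q - P)`, which is
integrable in `x`. -/
lemma controls_MaxSupBound_ZBound (hn : 1 ≤ n) {P Q : ℝ} (hP : 0 < P) (hPQ : P < Q) (σ : ℝ)
    (d : Whitney) :
    Controls (n := n) (MaxSupBound P σ d) (ZBound Q (σ - n / P + n / Q) d) := by
  have hQ : 0 < Q := hP.trans hPQ
  obtain ⟨C, hC, h⟩ := lintegral_whit_rpow_le hn hP hPQ hQ σ d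
  have hCt : C + 1 ≠ ∞ := by simp [hC]
  refine ⟨(C + 1) ^ (1 / Q), (ENNReal.rpow_pos (by simp) hCt).ne',
    ENNReal.rpow_ne_top_of_nonneg (by positivity) hCt, ?_⟩
  rintro g hg M hM0 hMt ⟨S, hS, hSM, hSz, hM⟩
  unfold ZBound
  rw [setLIntegral_upperHalf]
  · calc _ ≤ ∫⁻ x, C * (S x ^ (Q * (P / Q)) * M ^ (Q * (1 - P / Q))) :=
          lintegral_mono fun x => h g S M hM0 hMt hSz hM x
      _ = ∫⁻ x, (C * M ^ (Q - P)) * S x ^ P := by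
          refine lintegral_congr fun x => ?_
          rw [mul_div_cancel₀ _ hQ.ne', show Q * (1 - P / Q) = Q - P by field_simp]
          ring
      _ = C * M ^ (Q - P) * ∫⁻ x, S x ^ P := lintegral_const_mul _ (hS.pow_const P)
      _ ≤ (C + 1) * M ^ (Q - P) * M ^ P := by
          gcongr; exact le_self_add
      _ = _ := by
          rw [mul_assoc, ← ENNReal.rpow_add _ _ hM0 hMt, sub_add_cancel,
            ENNReal.mul_rpow_of_nonneg _ _ hQ.le, ← ENNReal.rpow_mul, one_div_mul_cancel hQ.ne',
            ENNReal.rpow_one]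
  · exact ((((measurable_wt _).comp measurable_fst).mul (measurable_whit d hg)).pow_const Q).mul
      ((measurable_wt _).comp measurable_fst)

/-- Whitney parameters large enough for cones to be covered by Whitney regions. -/
def bigWhitney : Whitney := ⟨2, 2, by norm_num, by norm_num⟩

/-- A point `w` of the cone over `x` lies in the big Whitney region of `(t, x)` for all `t` between
`w.1 / 2` and `w.1`. Averaging over these `t` and applying Tonelli yields a vertical integral. The
set `J` of heights makes truncated cones available too. -/
lemma setLIntegral_cone_le (σ : ℝ) : ∃ C : ℝ≥0∞, C ≠ ∞ ∧ ∀ g : Space n → ℝ≥0∞, Measurable g →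
    ∀ J : Set ℝ, MeasurableSet J → J ⊆ Set.Ioi 0 → (∀ t ∈ J, Set.Ioo (t / 2) t ⊆ J) →
    ∀ x, ∫⁻ z in {z : Space n | z ∈ cone x ∧ z.1 ∈ J}, wt (-(σ + (n + 1))) z.1 * g z
      ≤ C * ∫⁻ t in J, wt (-σ) t * whit bigWhitney g (t, x) * wt (-1) t := by
  -- The last `1` is the weight of `dt / t`, compensated by the length of the interval of averaging.
  set b : ℝ := -(σ + (n + 1) + 1) with hb
  set k := wt |b| 2 with hk
  refine ⟨ENNReal.ofReal 2 * k, ENNReal.mul_ne_top ENNReal.ofReal_ne_top (wt_ne_top _ two_pos), ?_⟩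
  intro g hg J hJ hJ0 hJd x
  let R : Set (ℝ × Space n) := {q | q.2 ∈ bigWhitney.region ((q.1, x) : Space n)}
  have hR : MeasurableSet R := by
    have hm : Measurable fun q : ℝ × Space n => (((q.1, x) : Space n), q.2) := by fun_prop
    exact hm (measurableSet_region_rel bigWhitney)
  have hcone : MeasurableSet {z : Space n | z ∈ cone x ∧ z.1 ∈ J} := by
    refine MeasurableSet.inter (s₁ := cone x) ?_ (measurable_fst hJ)
    exact (measurableSet_lt measurable_const measurable_fst).inter
      (measurableSet_lt (f := fun z : Space n => dist z.2 x) (by fun_prop) (by fun_prop))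
  have hinner : ∫⁻ t in J, wt (-σ) t * whit bigWhitney g (t, x) * wt (-1) t
      = ∫⁻ w : Space n, ∫⁻ t in {t | (t, w) ∈ R}, wt b t * g w ∂(volume.restrict J) := by
    rw [← lintegral_setLIntegral_fiber_swap (volume.restrict J) volume hR
      (G := fun q => wt b q.1 * g q.2)
      (((measurable_wt _).comp measurable_fst).mul (hg.comp measurable_snd))]
    refine setLIntegral_congr_fun hJ fun t ht => ?_
    have ht0 : 0 < t := hJ0 ht
    simp only [whit]
    rw [lintegral_const_mul _ hg]
    calc _ = (wt (-σ) t * wt (-(n + 1)) t) * wt (-1) t *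
          ∫⁻ w in bigWhitney.region ((t, x) : Space n), g w := by ring
      _ = _ := by
        rw [← wt_add _ _ ht0, wt_mul_wt ht0 (c := b) (by rw [hb]; ring)]
        rfl
  rw [hinner]
  have hmeas : Measurable fun w : Space n =>
      ∫⁻ t in {t | (t, w) ∈ R}, wt b t * g w ∂(volume.restrict J) := by
    have hswap : MeasurableSet {q : Space n × ℝ | (q.2, q.1) ∈ R} := measurable_swap hR
    have h1 := measurable_setLIntegral_fiber (volume.restrict J) hswap (measurable_wt b)
    have h2 : (fun w : Space n => ∫⁻ t in {t | (t, w) ∈ R}, wt b t * g w ∂(volume.restrict J))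
        = fun w => (∫⁻ t in {t | (t, w) ∈ R}, wt b t ∂(volume.restrict J)) * g w := by
      funext w
      exact lintegral_mul_const _ (measurable_wt b)
    rw [h2]
    exact h1.mul hg
  rw [← lintegral_const_mul _ hmeas]
  refine (setLIntegral_mono' hcone fun w hw => ?_).trans (setLIntegral_le_lintegral _ _)
  obtain ⟨⟨hw0, hwx⟩, hwJ⟩ := hw
  have hRw : MeasurableSet {t | (t, w) ∈ R} := measurable_prodMk_right hR
  have hsub : Set.Ioo (w.1 / 2) w.1 ⊆ {t | (t, w) ∈ R} ∩ J := by
    intro t ht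
    refine ⟨?_, hJd _ hwJ ht⟩
    change w ∈ bigWhitney.region ((t, x) : Space n)
    rw [Whitney.mem_region]
    simp only [bigWhitney]
    exact ⟨⟨by linarith [ht.2], by linarith [ht.1]⟩, by linarith [ht.1]⟩
  calc wt (-(σ + (n + 1))) w.1 * g w
      = ENNReal.ofReal 2 * ∫⁻ _ in Set.Ioo (w.1 / 2) w.1, wt b w.1 * g w := by
        rw [setLIntegral_const, Real.volume_Ioo, ← wt_mul_wt hw0 (a := b) (b := 1)
          (by rw [hb]; ring), wt_one_exp]
        have : ENNReal.ofReal w.1 = ENNReal.ofReal 2 * ENNReal.ofReal (w.1 - w.1 / 2) := by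
          rw [← ENNReal.ofReal_mul two_pos.le]; congr 1; ring
        rw [this]; ring
    _ ≤ ENNReal.ofReal 2 * ∫⁻ t in Set.Ioo (w.1 / 2) w.1, k * (wt b t * g w) := by
        refine mul_le_mul_right ?_ _
        refine setLIntegral_mono' measurableSet_Ioo fun t ht => ?_
        rw [← mul_assoc]
        gcongr
        exact wt_le_of_comparable b two_pos hw0 (by linarith [ht.1]) (by linarith [ht.1])
          (by linarith [ht.2])
    _ = ENNReal.ofReal 2 * k * ∫⁻ t in Set.Ioo (w.1 / 2) w.1, wt b t * g w := by
        rw [lintegral_const_mul _ ((measurable_wt b).mul_const _), mul_assoc]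
    _ ≤ _ := by
        rw [Measure.restrict_restrict hRw]
        exact mul_le_mul_right (lintegral_mono_set hsub) _

/-- The case `r = 1` bounds the squared conical function pointwise by a multiple of `S ^ (P / Q) * M
^ (1 - P / Q)`, whose `Q`-th power is integrable. -/
lemma controls_MaxSupBound_TBound (hn : 1 ≤ n) {P Q : ℝ} (hP : 0 < P) (hPQ : P < Q) (σ : ℝ) :
    Controls (n := n) (MaxSupBound P σ bigWhitney) (TBound Q (σ - n / P + n / Q)) := by
  have hQ : 0 < Q := hP.trans hPQ
  obtain ⟨C, hC, h⟩ := lintegral_whit_rpow_le hn hP hPQ one_pos σ bigWhitney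
  obtain ⟨C', hC', h'⟩ := setLIntegral_cone_le (n := n) (σ - n / P + n / Q)
  have hCt : C' * C + 1 ≠ ∞ := by simp [ENNReal.mul_ne_top hC' hC]
  refine ⟨C' * C + 1, by simp, hCt, ?_⟩
  rintro g hg M hM0 hMt ⟨S, hS, hSM, hSz, hM⟩
  have hpt : ∀ x, ∫⁻ z in cone x, wt (-((σ - n / P + n / Q) + (n + 1))) z.1 * g z
      ≤ (C' * C + 1) * (S x ^ (P / Q) * M ^ (1 - P / Q)) := by
    intro x
    have h1 := h' g hg (Set.Ioi 0) measurableSet_Ioi le_rfl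
      (fun t ht s hs => lt_trans (half_pos ht) hs.1) x
    have h2 : {z : Space n | z ∈ cone x ∧ z.1 ∈ Set.Ioi (0 : ℝ)} = cone x := by
      ext z; simp only [cone, Set.mem_ofPred_eq, Set.mem_Ioi]; tauto
    have h3 := h g S M hM0 hMt hSz hM x
    simp only [ENNReal.rpow_one, one_mul] at h3
    rw [h2] at h1
    calc _ ≤ _ := h1
      _ ≤ C' * (C * (S x ^ (P / Q) * M ^ (1 - P / Q))) := by gcongr
      _ ≤ _ := by rw [← mul_assoc]; gcongr; exact le_self_add
  unfold TBound
  calc _ ≤ ∫⁻ x, ((C' * C + 1) * (S x ^ (P / Q) * M ^ (1 - P / Q))) ^ Q := by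
        refine lintegral_mono fun x => ?_
        gcongr
        exact hpt x
    _ = ∫⁻ x, ((C' * C + 1) ^ Q * M ^ (Q - P)) * S x ^ P := by
        refine lintegral_congr fun x => ?_
        rw [ENNReal.mul_rpow_of_nonneg _ _ hQ.le, ENNReal.mul_rpow_of_nonneg _ _ hQ.le,
          ← ENNReal.rpow_mul, ← ENNReal.rpow_mul, div_mul_cancel₀ _ hQ.ne',
          show (1 - P / Q) * Q = Q - P by field_simp]
        ring
    _ = (C' * C + 1) ^ Q * M ^ (Q - P) * ∫⁻ x, S x ^ P := lintegral_const_mul _ (hS.pow_const P)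
    _ ≤ (C' * C + 1) ^ Q * M ^ (Q - P) * M ^ P := by gcongr
    _ = _ := by
        rw [mul_assoc, ← ENNReal.rpow_add _ _ hM0 hMt, sub_add_cancel,
          ENNReal.mul_rpow_of_nonneg _ _ hQ.le]

/-! ### From the maximal bound to Carleson norms -/

lemma measurableSet_tent (x : EuclideanSpace ℝ (Fin n)) (r : ℝ) : MeasurableSet (tent x r) :=
  (measurableSet_lt measurable_const measurable_fst).inter
    (measurableSet_le (f := fun z : Space n => dist z.2 x + z.1) (by fun_prop) (by fun_prop))

/-- For `(t, y)` in the tent, the ball `B(y, t)` lies in `B(x₀, r)` and `t ≤ r`. Averaging over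
vertices in `B(y, t)` replaces the tent by cones truncated at height `r` with vertices in `B(x₀,
r)`, to which `setLIntegral_cone_le` applies. -/
lemma setLIntegral_tent_le (σ : ℝ) : ∃ C : ℝ≥0∞, C ≠ ∞ ∧ ∀ g : Space n → ℝ≥0∞, Measurable g →
    ∀ (x₀ : EuclideanSpace ℝ (Fin n)) (r : ℝ), 0 < r →
      ∫⁻ z in tent x₀ r, wt (-(σ + 1)) z.1 * g z
        ≤ C * ∫⁻ x in Metric.ball x₀ r, ∫⁻ t in Set.Ioc 0 r,
          wt (-σ) t * whit bigWhitney g (t, x) * wt (-1) t := by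
  obtain ⟨C, hC, h⟩ := setLIntegral_cone_le (n := n) σ
  have hκ0 := unitBallVolume_ne_zero (n := n)
  have hκt := unitBallVolume_ne_top (n := n)
  set κ := unitBallVolume n
  refine ⟨κ⁻¹ * C, ENNReal.mul_ne_top (ENNReal.inv_ne_top.2 hκ0) hC, ?_⟩
  intro g hg x₀ r hr
  let R : Set (EuclideanSpace ℝ (Fin n) × Space n) := {q | q.2 ∈ cone q.1 ∧ q.2.1 ∈ Set.Ioc 0 r}
  have hR : MeasurableSet R := by
    refine MeasurableSet.inter (s₁ := {q : EuclideanSpace ℝ (Fin n) × Space n | q.2 ∈ cone q.1}) ?_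
      ((measurable_fst.comp measurable_snd) measurableSet_Ioc)
    exact (measurableSet_lt measurable_const (measurable_fst.comp measurable_snd)).inter
      (measurableSet_lt (f := fun q : EuclideanSpace ℝ (Fin n) × Space n => dist q.2.2 q.1)
        (by fun_prop) (by fun_prop))
  have hφ : Measurable fun z : Space n => wt (-(σ + (n + 1))) z.1 * g z :=
    ((measurable_wt _).comp measurable_fst).mul hg
  calc ∫⁻ z in tent x₀ r, wt (-(σ + 1)) z.1 * g z
      ≤ ∫⁻ z in tent x₀ r, κ⁻¹ * ∫⁻ _ in {x | (x, z) ∈ R}, wt (-(σ + (n + 1))) z.1 * g z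
          ∂(volume.restrict (Metric.ball x₀ r)) := by
        refine setLIntegral_mono' (measurableSet_tent _ _) fun z hz => ?_
        obtain ⟨hz0, hz1⟩ := hz
        have hsub : Metric.ball z.2 z.1 ⊆ {x | (x, z) ∈ R} ∩ Metric.ball x₀ r := by
          intro x hx
          have hx' := Metric.mem_ball.1 hx
          refine ⟨⟨⟨hz0, by rwa [dist_comm]⟩, hz0, ?_⟩, Metric.mem_ball.2 ?_⟩
          · have := dist_nonneg (x := z.2) (y := x₀)
            linarith
          · have := dist_triangle x z.2 x₀
            linarith
        have hRz : MeasurableSet {x | (x, z) ∈ R} := measurable_prodMk_right hR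
        rw [Measure.restrict_restrict hRz]
        calc wt (-(σ + 1)) z.1 * g z
            = κ⁻¹ * ∫⁻ _ in Metric.ball z.2 z.1, wt (-(σ + (n + 1))) z.1 * g z := by
              rw [setLIntegral_const, volume_ball_eq_wt _ hz0,
                ← wt_mul_wt hz0 (a := -(σ + (n + 1))) (b := n) (by ring)]
              calc _ = (κ⁻¹ * κ) * (wt (-(σ + (n + 1))) z.1 * wt n z.1 * g z) := by
                    rw [ENNReal.inv_mul_cancel hκ0 hκt, one_mul]
                _ = _ := by ring
          _ ≤ _ := mul_le_mul_right (lintegral_mono_set hsub) _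
    _ ≤ ∫⁻ z, κ⁻¹ * ∫⁻ _ in {x | (x, z) ∈ R}, wt (-(σ + (n + 1))) z.1 * g z
          ∂(volume.restrict (Metric.ball x₀ r)) := setLIntegral_le_lintegral _ _
    _ = κ⁻¹ * ∫⁻ x in Metric.ball x₀ r, ∫⁻ z in {z | (x, z) ∈ R},
          wt (-(σ + (n + 1))) z.1 * g z := by
        rw [lintegral_const_mul' _ _ (ENNReal.inv_ne_top.2 hκ0),
          ← lintegral_setLIntegral_fiber_swap (volume.restrict (Metric.ball x₀ r)) volume hR
            (G := fun q => wt (-(σ + (n + 1))) q.2.1 * g q.2) (hφ.comp measurable_snd)]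
    _ ≤ κ⁻¹ * ∫⁻ x in Metric.ball x₀ r, C * ∫⁻ t in Set.Ioc 0 r,
          wt (-σ) t * whit bigWhitney g (t, x) * wt (-1) t := by
        gcongr with x
        exact h g hg (Set.Ioc 0 r) measurableSet_Ioc (fun t ht => ht.1)
          (fun t ht s hs => ⟨by linarith [ht.1, hs.1], by linarith [ht.2, hs.2]⟩) x
    _ = _ := by rw [lintegral_const_mul' _ _ hC, mul_assoc]

/-- For `y ≤ M` the left side is at most `M`; for `y ≥ M`, raising the power of `y / M` from `m` to
`P` only increases it. This passes to the power `P`, in which `S` is integrable. -/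
lemma rpow_mul_rpow_le_add {M : ℝ≥0∞} (hM0 : M ≠ 0) (hMt : M ≠ ∞) {m P : ℝ} (hm : 0 ≤ m)
    (hmP : m ≤ P) (y : ℝ≥0∞) : M ^ (1 - m) * y ^ m ≤ M + M ^ (1 - P) * y ^ P := by
  rcases le_total y M with h | h
  · calc M ^ (1 - m) * y ^ m ≤ M ^ (1 - m) * M ^ m := by gcongr
      _ = M := by rw [← ENNReal.rpow_add _ _ hM0 hMt, sub_add_cancel, ENNReal.rpow_one]
      _ ≤ _ := le_self_add
  · calc M ^ (1 - m) * y ^ m = M ^ (1 - P) * (M ^ (P - m) * y ^ m) := by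
          rw [← mul_assoc, ← ENNReal.rpow_add _ _ hM0 hMt]; congr 2; ring
      _ ≤ M ^ (1 - P) * (y ^ (P - m) * y ^ m) := by
          gcongr
      _ = M ^ (1 - P) * y ^ P := by
          rw [← ENNReal.rpow_add_of_nonneg _ _ (sub_nonneg.2 hmP) hm, sub_add_cancel]
      _ ≤ _ := le_add_self

/-- Below height `r` the factor `t ^ A` is at most `r ^ A`, so even `A = 0` is harmless: convergence
at `t = 0` comes from the bound `t ^ (n/P) * S x`, used to a power `m`. Integrated over the ball,
both resulting terms are of size `M * r ^ (n + A)`. -/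
lemma controls_MaxSupBound_TBoundTop (hn : 1 ≤ n) {P A : ℝ} (hP : 0 < P) (hA : 0 ≤ A) (σ : ℝ) :
    Controls (n := n) (MaxSupBound P σ bigWhitney) (TBoundTop A (σ - n / P - A)) := by
  have hn0 : (0 : ℝ) < n := by exact_mod_cast hn
  obtain ⟨C, hC, h⟩ := setLIntegral_tent_le (n := n) (σ - n / P - A)
  -- `m ≤ 1` lets the remaining power `1 - m` fall on the bound `M`; `m ≤ P` allows the later
  -- passage to `S ^ P`.
  set m : ℝ := min 1 P with hm
  have hm0 : 0 < m := lt_min one_pos hP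
  have hm1 : m ≤ 1 := min_le_left _ _
  have hmP : m ≤ P := min_le_right _ _
  set N : ℝ := n / P with hN
  have hN0 : 0 < N := by positivity
  set k := ENNReal.ofReal (N * m)⁻¹ with hk
  set κ := unitBallVolume n with hκ
  have hCt : C * (k * (κ + 1)) + 1 ≠ ∞ := by
    exact ENNReal.add_ne_top.2 ⟨ENNReal.mul_ne_top hC (ENNReal.mul_ne_top ENNReal.ofReal_ne_top
      (ENNReal.add_ne_top.2 ⟨unitBallVolume_ne_top, ENNReal.one_ne_top⟩)), ENNReal.one_ne_top⟩
  refine ⟨C * (k * (κ + 1)) + 1, by simp, hCt, ?_⟩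
  rintro g hg M hM0 hMt ⟨S, hS, hSM, hSz, hM⟩ x₀ r hr
  have hpt : ∀ x, ∫⁻ t in Set.Ioc 0 r,
      wt (-(σ - N - A)) t * whit bigWhitney g (t, x) * wt (-1) t
        ≤ wt A r * k * (M + M ^ (1 - P) * wt n r * S x ^ P) := by
    intro x
    calc ∫⁻ t in Set.Ioc 0 r, wt (-(σ - N - A)) t * whit bigWhitney g (t, x) * wt (-1) t
        ≤ ∫⁻ t in Set.Ioc 0 r, (wt A r * (M ^ (1 - m) * S x ^ m)) * wt (N * m - 1) t := by
          refine setLIntegral_mono' measurableSet_Ioc fun t ht => ?_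
          set v := wt (-(σ - N)) t * whit bigWhitney g (t, x) with hv
          have hv1 : v ≤ M := hM (t, x) ht.1
          have hv2 : v ≤ wt N t * S x := by
            have := hSz (t, x) ht.1
            calc v = wt N t * (wt (-σ) t * whit bigWhitney g (t, x)) := by
                  rw [hv, ← mul_assoc, wt_mul_wt ht.1 (c := -(σ - N)) (by ring)]
              _ ≤ _ := by gcongr
          calc wt (-(σ - N - A)) t * whit bigWhitney g (t, x) * wt (-1) t
              = wt A t * v * wt (-1) t := by
                rw [hv, ← mul_assoc, wt_mul_wt ht.1 (c := -(σ - N - A)) (by ring)]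
            _ = wt A t * (v ^ (1 - m) * v ^ m) * wt (-1) t := by
                rw [← ENNReal.rpow_add_of_nonneg _ _ (sub_nonneg.2 hm1) hm0.le, sub_add_cancel,
                  ENNReal.rpow_one]
            _ ≤ wt A r * (M ^ (1 - m) * (wt N t * S x) ^ m) * wt (-1) t := by
                gcongr
                exact wt_mono hA ht.2
            _ = _ := by
                rw [ENNReal.mul_rpow_of_nonneg _ _ hm0.le, wt_rpow,
                  sub_eq_add_neg (N * m), wt_add _ _ ht.1]
                ring
      _ = wt A r * k * (M ^ (1 - m) * (wt N r * S x) ^ m) := by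
          rw [lintegral_const_mul _ (measurable_wt _), lintegral_wt_Ioc (by positivity) hr,
            ENNReal.mul_rpow_of_nonneg _ _ hm0.le, wt_rpow]
          ring
      _ ≤ wt A r * k * (M + M ^ (1 - P) * (wt N r * S x) ^ P) := by
          gcongr
          exact rpow_mul_rpow_le_add hM0 hMt hm0.le hmP _
      _ = _ := by
          rw [ENNReal.mul_rpow_of_nonneg _ _ hP.le, wt_rpow, hN, div_mul_cancel₀ _ hP.ne',
            mul_assoc (M ^ (1 - P))]
  calc _ ≤ _ := h g hg x₀ r hr
    _ ≤ C * ∫⁻ x in Metric.ball x₀ r, wt A r * k * (M + M ^ (1 - P) * wt n r * S x ^ P) := by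
        gcongr with x
        exact hpt x
    _ = C * (wt A r * k * (M * (κ * wt n r) +
          M ^ (1 - P) * wt n r * ∫⁻ x in Metric.ball x₀ r, S x ^ P)) := by
        rw [lintegral_const_mul _ ((hS.pow_const P).const_mul _ |>.const_add _),
          lintegral_add_left measurable_const, setLIntegral_const,
          lintegral_const_mul _ (hS.pow_const P), volume_ball_eq_wt _ hr]
    _ ≤ C * (wt A r * k * (M * (κ * wt n r) + M ^ (1 - P) * wt n r * M ^ P)) := by
        gcongr
        exact (setLIntegral_le_lintegral _ _).trans hSM
    _ = C * (k * (κ + 1)) * M * wt (n + A) r := by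
        have : M ^ (1 - P) * M ^ P = M := by
          rw [← ENNReal.rpow_add _ _ hM0 hMt, sub_add_cancel, ENNReal.rpow_one]
        calc _ = C * (wt A r * k * (M * (κ * wt n r) + (M ^ (1 - P) * M ^ P) * wt n r)) := by ring
          _ = _ := by rw [this, wt_add _ _ hr]; ring
    _ ≤ _ := by gcongr; exact le_self_add

/-! ### Infinite exponents on both sides -/

lemma controls_ZBoundTop_ZBoundTop (ρ : ℝ) (c d : Whitney) :
    Controls (n := n) (ZBoundTop ρ c) (ZBoundTop ρ d) := by
  obtain ⟨C, hC0, hCt, h⟩ := whit_le_of_ae_le (n := n) c d ρ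
  refine ⟨C, hC0, hCt, fun g _ M _ _ hM => h g M ?_⟩
  filter_upwards [ae_restrict_mem measurableSet_upperHalf] with z hz
  exact hM z hz

/-- The pointwise bound leaves `t ^ (A - 1)` to be integrated over `(0, r]`, which converges exactly
because `A > 0`. -/
lemma controls_ZBoundTop_TBoundTop {A : ℝ} (hA : 0 < A) (ρ : ℝ) (c : Whitney) :
    Controls (n := n) (ZBoundTop ρ c) (TBoundTop A (ρ - A)) := by
  refine (controls_ZBoundTop_ZBoundTop ρ c bigWhitney).trans ?_
  obtain ⟨C, hC, h⟩ := setLIntegral_tent_le (n := n) (ρ - A)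
  set C' := C * (ENNReal.ofReal A⁻¹ * unitBallVolume n) with hC'
  have hCt : C' ≠ ∞ :=
    ENNReal.mul_ne_top hC (ENNReal.mul_ne_top ENNReal.ofReal_ne_top unitBallVolume_ne_top)
  refine ⟨C' + 1, by simp, by simp [hCt], fun g hg M _ hMt hM x₀ r hr => ?_⟩
  calc _ ≤ _ := h g hg x₀ r hr
    _ ≤ C * ∫⁻ _ in Metric.ball x₀ r, ∫⁻ t in Set.Ioc 0 r, M * wt (A - 1) t := by
        refine mul_le_mul_right (lintegral_mono fun x => ?_) _
        refine setLIntegral_mono' measurableSet_Ioc fun t ht => ?_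
        have := hM (t, x) ht.1
        calc _ = (wt (-ρ) t * whit bigWhitney g (t, x)) * (wt A t * wt (-1) t) := by
              rw [neg_sub, sub_eq_add_neg, wt_add _ _ ht.1]; ring
          _ ≤ M * wt (A - 1) t := by
              rw [← wt_add _ _ ht.1, ← sub_eq_add_neg]
              gcongr
    _ = C' * M * wt (n + A) r := by
        rw [setLIntegral_const, lintegral_const_mul _ (measurable_wt _), lintegral_wt_Ioc hA hr,
          volume_ball_eq_wt _ hr, hC', wt_add _ _ hr]
        ring
    _ ≤ _ := by gcongr; exact le_self_add

/-- A Whitney region at height `t` lies in the tent over the concentric ball of radius `(c₀ + c₁) *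
t`, so the Carleson condition on that single ball suffices. -/
lemma controls_TBoundTop_ZBoundTop {A : ℝ} (σ : ℝ) (c : Whitney) :
    Controls (n := n) (TBoundTop A σ) (ZBoundTop (σ + A) c) := by
  set b := -(σ + 1) with hb
  have hL : 0 < c.c₀ + c.c₁ := add_pos c.c₀_pos c.c₁_pos
  refine ⟨wt |b| c.c₁ * wt (n + A) (c.c₀ + c.c₁),
    mul_ne_zero (wt_ne_zero _ c.c₁_pos) (wt_ne_zero _ hL),
    ENNReal.mul_ne_top (wt_ne_top _ c.c₁_pos) (wt_ne_top _ hL), ?_⟩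
  intro g hg M _ _ hM z hz
  have hφ : Measurable fun w : Space n => wt b w.1 * g w :=
    ((measurable_wt _).comp measurable_fst).mul hg
  have h1 : wt b z.1 * ∫⁻ w in c.region z, g w
      ≤ wt |b| c.c₁ * ∫⁻ w in tent z.2 ((c.c₀ + c.c₁) * z.1), wt b w.1 * g w := by
    rw [← lintegral_const_mul _ hg, ← lintegral_const_mul _ hφ]
    refine (setLIntegral_mono' (g := fun w => wt |b| c.c₁ * (wt b w.1 * g w))
      (c.isOpen_region z).measurableSet fun w hw => ?_).trans
      (lintegral_mono_set fun w hw => ?_)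
    · rw [← mul_assoc]
      gcongr
      exact (c.wt_le_of_mem_region b hz hw).1
    · refine ⟨Whitney.pos_of_mem_region hz hw, ?_⟩
      rw [Whitney.mem_region] at hw
      linarith [hw.1.2, hw.2]
  calc wt (-(σ + A)) z.1 * whit c g z
      = wt (-(n + A)) z.1 * (wt b z.1 * ∫⁻ w in c.region z, g w) := by
        rw [whit, ← mul_assoc, ← mul_assoc, ← wt_add _ _ hz, ← wt_add _ _ hz]
        congr 2
        rw [hb]; ring
    _ ≤ wt (-(n + A)) z.1 * (wt |b| c.c₁ * (M * wt (n + A) ((c.c₀ + c.c₁) * z.1))) := by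
        refine mul_le_mul_right (h1.trans (mul_le_mul_right ?_ _)) _
        exact hM _ _ (mul_pos hL hz)
    _ = (wt (-(n + A)) z.1 * wt (n + A) z.1) * (wt |b| c.c₁ * wt (n + A) (c.c₀ + c.c₁) * M) := by
        rw [wt_mul _ hL]; ring
    _ = _ := by rw [wt_neg_mul_cancel _ hz, one_mul]

/-! ### Translation between quasi-norms and bounds -/

/-- `M` bounds, up to a constant, the squared quasi-norm of `X^𝐩`, in terms of the squared
modulus `g` of the function. -/
def Scale.bound (X : Scale) (c : Whitney) (p : Exponent) (g : Space n → ℝ≥0∞) (M : ℝ≥0∞) : Prop :=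
  match X, p with
  | .T, .finite p s _ => TBound (p / 2) (2 * s) g M
  | .T, .infinite s α _ => TBoundTop (2 * α) (2 * s) g M
  | .Z, .finite p s _ => ZBound (p / 2) (2 * s) c g M
  | .Z, .infinite s α _ => ZBoundTop (2 * (s + α)) c g M

section Norms

variable {F : Type*} [NormedAddCommGroup F] [NormedSpace ℝ F]

lemma enorm_kappa_sq (s : ℝ) (f : Space n → F) {z : Space n} (hz : 0 < z.1) :
    ‖kappa (-s) f z‖ₑ ^ 2 = wt (-(2 * s)) z.1 * ‖f z‖ₑ ^ 2 := by
  rw [kappa, enorm_smul, mul_pow, Real.enorm_of_nonneg (Real.rpow_nonneg hz.le _),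
    ← wt_eq_ofReal _ hz, ← ENNReal.rpow_natCast, wt_rpow]
  congr 2
  push_cast; ring

lemma conical_kappa (s : ℝ) (f : Space n → F) (x : EuclideanSpace ℝ (Fin n)) :
    conical (kappa (-s) f) x
      = (∫⁻ z in cone x, wt (-(2 * s + (n + 1))) z.1 * ‖f z‖ₑ ^ 2) ^ (1 / 2 : ℝ) := by
  have hcone : MeasurableSet (cone x : Set (Space n)) :=
    (measurableSet_lt measurable_const measurable_fst).inter
      (measurableSet_lt (f := fun z : Space n => dist z.2 x) (by fun_prop) (by fun_prop))
  unfold conical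
  congr 1
  refine setLIntegral_congr_fun hcone fun z hz => ?_
  have hz0 : 0 < z.1 := hz.1
  have h1 : ENNReal.ofReal (1 / z.1 ^ (n + 1)) = wt (-(n + 1)) z.1 := by
    rw [wt_eq_ofReal _ hz0, Real.rpow_neg hz0.le, one_div]
    congr 2
    exact_mod_cast (Real.rpow_natCast z.1 (n + 1)).symm
  rw [enorm_kappa_sq s f hz0, h1,
    ← wt_mul_wt hz0 (a := -(2 * s)) (b := -(n + 1)) (c := -(2 * s + (n + 1))) (by ring)]
  ring

lemma eLpNorm_le_iff {α : Type*} [MeasurableSpace α] {μ : Measure α} {p : ℝ} (hp : 0 < p)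
    (u : α → ℝ≥0∞) (N : ℝ≥0∞) :
    eLpNorm u (ENNReal.ofReal p) μ ≤ N ↔ ∫⁻ x, u x ^ p ∂μ ≤ N ^ p := by
  rw [eLpNorm_eq_lintegral_rpow_enorm_toReal (ENNReal.ofReal_pos.2 hp).ne' ENNReal.ofReal_ne_top,
    ENNReal.toReal_ofReal hp.le, one_div, ENNReal.rpow_inv_le_iff hp]
  simp

lemma sq_rpow_half (N : ℝ≥0∞) (p : ℝ) : (N ^ 2) ^ (p / 2) = N ^ p := by
  rw [← ENNReal.rpow_natCast, ← ENNReal.rpow_mul]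
  congr 1
  push_cast; ring

lemma rpow_half_rpow (X : ℝ≥0∞) (p : ℝ) : (X ^ (1 / 2 : ℝ)) ^ p = X ^ (p / 2) := by
  rw [← ENNReal.rpow_mul]
  congr 1
  ring

lemma rpow_half_le_iff (X N : ℝ≥0∞) : X ^ (1 / 2 : ℝ) ≤ N ↔ X ≤ N ^ 2 := by
  rw [one_div, ENNReal.rpow_inv_le_iff two_pos, ENNReal.rpow_two]

lemma tentNorm_finite_le_iff {p s : ℝ} (hp : 0 < p) (f : Space n → F) (N : ℝ≥0∞) :
    tentNorm f (.finite p s hp) ≤ N ↔ TBound (p / 2) (2 * s) (fun z => ‖f z‖ₑ ^ 2) (N ^ 2) := by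
  unfold TBound
  rw [tentNorm, eLpNorm_le_iff hp, sq_rpow_half]
  simp only [conical_kappa, rpow_half_rpow]

lemma tentNorm_infinite_le_iff {s α : ℝ} (hα : 0 ≤ α) (f : Space n → F) (N : ℝ≥0∞) :
    tentNorm f (.infinite s α hα) ≤ N ↔
      TBoundTop (2 * α) (2 * s) (fun z => ‖f z‖ₑ ^ 2) (unitBallVolume n * N ^ 2) := by
  have hκ0 := unitBallVolume_ne_zero (n := n)
  have hκt := unitBallVolume_ne_top (n := n)
  simp only [tentNorm, carleson, iSup_le_iff, TBoundTop]
  refine forall_congr' fun x => forall_congr' fun r => forall_congr' fun hr => ?_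
  have h1 : ∫⁻ z in tent x r, ‖kappa (-s) f z‖ₑ ^ 2 * ENNReal.ofReal (1 / z.1)
      = ∫⁻ z in tent x r, wt (-(2 * s + 1)) z.1 * ‖f z‖ₑ ^ 2 := by
    refine setLIntegral_congr_fun (measurableSet_tent x r) fun z hz => ?_
    have hz0 : 0 < z.1 := hz.1
    have h2 : ENNReal.ofReal (1 / z.1) = wt (-1) z.1 := by
      rw [wt_eq_ofReal _ hz0, Real.rpow_neg_one, one_div]
    rw [enorm_kappa_sq s f hz0, h2, ← wt_mul_wt hz0 (a := -(2 * s)) (b := -1)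
      (c := -(2 * s + 1)) (by ring)]
    ring
  rw [h1, volume_ball_eq_wt x hr, ← wt_eq_ofReal _ hr]
  set I := ∫⁻ z in tent x r, wt (-(2 * s + 1)) z.1 * ‖f z‖ₑ ^ 2
  have h3 : wt (-α) r * ((unitBallVolume n * wt n r)⁻¹ * I) ^ (1 / 2 : ℝ)
      = ((unitBallVolume n * wt (n + 2 * α) r)⁻¹ * I) ^ (1 / 2 : ℝ) := by
    have h4 : wt (-α) r = wt (-(2 * α)) r ^ (1 / 2 : ℝ) := by
      rw [wt_rpow]; congr 1; ring
    rw [h4, ← ENNReal.mul_rpow_of_nonneg _ _ (by norm_num), ← mul_assoc, ← wt_inv, wt_add _ _ hr,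
      ← mul_assoc, ENNReal.mul_inv (a := unitBallVolume n * wt n r), mul_comm (wt (2 * α) r)⁻¹]
    · exact Or.inr (wt_ne_top _ hr)
    · exact Or.inr (wt_ne_zero _ hr)
  rw [h3, rpow_half_le_iff, ENNReal.inv_mul_le_iff (mul_ne_zero hκ0 (wt_ne_zero _ hr))
    (ENNReal.mul_ne_top hκt (wt_ne_top _ hr))]
  rw [mul_right_comm]

/-- The power weight varies only by a bounded factor on a Whitney region, so it can be moved out of
the average. -/
lemma average_kappa_comparable (c : Whitney) (s : ℝ) : ∃ C : ℝ≥0∞, C ≠ 0 ∧ C ≠ ∞ ∧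
    ∀ (f : Space n → F), Measurable (fun z => ‖f z‖ₑ) → ∀ z : Space n, 0 < z.1 →
      c.average (kappa (-s) f) z
        ≤ (C * (wt (-(2 * s)) z.1 * whit c (fun z => ‖f z‖ₑ ^ 2) z)) ^ (1 / 2 : ℝ) ∧
      wt (-(2 * s)) z.1 * whit c (fun z => ‖f z‖ₑ ^ 2) z
        ≤ C * c.average (kappa (-s) f) z ^ 2 := by
  obtain ⟨κ, hκ0, hκt, hκ⟩ := c.volume_region (n := n)
  set b := -(2 * s) with hb
  set k := wt |b| c.c₁ with hk
  have hkt : k ≠ ∞ := wt_ne_top _ c.c₁_pos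
  have hk0 : k ≠ 0 := wt_ne_zero _ c.c₁_pos
  have hκi := ENNReal.inv_ne_top.2 hκ0
  refine ⟨k * κ⁻¹ + k * κ, ?_, ?_, ?_⟩
  · simp [hk0, hκ0]
  · exact ENNReal.add_ne_top.2 ⟨ENNReal.mul_ne_top hkt hκi, ENNReal.mul_ne_top hkt hκt⟩
  intro f hf z hz
  set g : Space n → ℝ≥0∞ := fun z => ‖f z‖ₑ ^ 2 with hg
  have hgm : Measurable g := hf.pow_const 2
  set I := ∫⁻ w in c.region z, wt b w.1 * g w with hI
  have hφ : Measurable fun w : Space n => wt b w.1 * g w :=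
    ((measurable_wt _).comp measurable_fst).mul hgm
  have havg : c.average (kappa (-s) f) z = (κ⁻¹ * (wt (-(n + 1)) z.1 * I)) ^ (1 / 2 : ℝ) := by
    unfold Whitney.average
    rw [setLAverage_eq, hκ z hz, ENNReal.div_eq_inv_mul,
      ENNReal.mul_inv (Or.inl hκ0) (Or.inl hκt), wt_inv, mul_assoc]
    congr 3
    refine setLIntegral_congr_fun (c.isOpen_region z).measurableSet fun w hw => ?_
    exact enorm_kappa_sq s f (Whitney.pos_of_mem_region hz hw)
  have hI1 : I ≤ k * (wt b z.1 * ∫⁻ w in c.region z, g w) := by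
    rw [hI, ← mul_assoc, ← lintegral_const_mul _ hgm]
    refine setLIntegral_mono' (c.isOpen_region z).measurableSet fun w hw => ?_
    gcongr
    exact (c.wt_le_of_mem_region b hz hw).2
  have hI2 : wt b z.1 * ∫⁻ w in c.region z, g w ≤ k * I := by
    rw [hI, ← lintegral_const_mul _ hφ, ← lintegral_const_mul _ hgm]
    refine setLIntegral_mono' (c.isOpen_region z).measurableSet fun w hw => ?_
    rw [← mul_assoc]
    gcongr
    exact (c.wt_le_of_mem_region b hz hw).1
  constructor
  · rw [havg]
    refine ENNReal.rpow_le_rpow ?_ (by norm_num)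
    calc κ⁻¹ * (wt (-(n + 1)) z.1 * I)
        ≤ κ⁻¹ * (wt (-(n + 1)) z.1 * (k * (wt b z.1 * ∫⁻ w in c.region z, g w))) := by gcongr
      _ = k * κ⁻¹ * (wt b z.1 * whit c g z) := by rw [whit]; ring
      _ ≤ _ := by gcongr; exact le_self_add
  · rw [havg, ← ENNReal.rpow_two, ← ENNReal.rpow_mul, one_div_mul_cancel two_ne_zero,
      ENNReal.rpow_one]
    calc wt b z.1 * whit c g z = wt (-(n + 1)) z.1 * (wt b z.1 * ∫⁻ w in c.region z, g w) := by
          rw [whit]; ring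
      _ ≤ wt (-(n + 1)) z.1 * (k * I) := by gcongr
      _ = (κ * κ⁻¹) * (wt (-(n + 1)) z.1 * (k * I)) := by
          rw [ENNReal.mul_inv_cancel hκ0 hκt, one_mul]
      _ = k * κ * (κ⁻¹ * (wt (-(n + 1)) z.1 * I)) := by ring
      _ ≤ _ := by gcongr; exact le_add_self

lemma lintegral_haarUpper (φ : Space n → ℝ≥0∞) :
    ∫⁻ z, φ z ∂haarUpper n = ∫⁻ z in upperHalf n, φ z * wt (-1) z.1 := by
  unfold haarUpper
  -- Finiteness of the density dispenses with measurability of `φ`.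
  rw [lintegral_withDensity_eq_lintegral_mul_non_measurable _ (by fun_prop) (by simp)]
  refine setLIntegral_congr_fun measurableSet_upperHalf fun z hz => ?_
  have hz0 : 0 < z.1 := hz
  rw [wt_eq_ofReal _ hz0, Real.rpow_neg_one, Pi.mul_apply, one_div, mul_comm]

lemma ae_haarUpper_iff {Φ : Space n → Prop} :
    (∀ᵐ z ∂haarUpper n, Φ z) ↔ ∀ᵐ z ∂(volume : Measure (Space n)).restrict (upperHalf n), Φ z := by
  refine ⟨fun h => ?_, fun h => (withDensity_absolutelyContinuous _ _).ae_le h⟩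
  refine (withDensity_absolutelyContinuous' (by fun_prop) ?_).ae_le h
  filter_upwards [ae_restrict_mem measurableSet_upperHalf] with z hz
  exact (ENNReal.ofReal_pos.2 (one_div_pos.2 hz)).ne'

/-- The quasi-norm of `X^𝐩` expressed through the squared modulus. -/
def Scale.norm (X : Scale) (c : Whitney) (p : Exponent) (f : Space n → F) : ℝ≥0∞ :=
  match X with
  | .T => tentNorm f p
  | .Z => zNorm c f p

lemma Scale.bound_of_norm_le (X : Scale) (c : Whitney) (p : Exponent) :
    ∃ C : ℝ≥0∞, C ≠ 0 ∧ C ≠ ∞ ∧ ∀ f : Space n → F, Measurable (fun z => ‖f z‖ₑ) →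
      ∀ N : ℝ≥0∞, X.norm c p f ≤ N → X.bound c p (fun z => ‖f z‖ₑ ^ 2) (C * N ^ 2) := by
  cases X with
  | T =>
    cases p with
    | finite p s hp =>
      refine ⟨1, one_ne_zero, ENNReal.one_ne_top, fun f _ N h => ?_⟩
      rw [one_mul]
      exact (tentNorm_finite_le_iff hp f N).1 h
    | infinite s α hα =>
      exact ⟨unitBallVolume n, unitBallVolume_ne_zero, unitBallVolume_ne_top,
        fun f _ N h => (tentNorm_infinite_le_iff hα f N).1 h⟩
  | Z =>
    obtain ⟨C, hC0, hCt, hC⟩ := average_kappa_comparable (n := n) (F := F) c p.reg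
    cases p with
    | finite p s hp =>
      refine ⟨C, hC0, hCt, fun f hf N h => ?_⟩
      have h' := (eLpNorm_le_iff hp _ N).1 h
      rw [lintegral_haarUpper] at h'
      simp only [Exponent.reg] at hC h'
      change ZBound (p / 2) (2 * s) c _ _
      have hp2 : 0 ≤ p / 2 := by positivity
      unfold ZBound
      calc _ ≤ ∫⁻ z in upperHalf n, C ^ (p / 2) *
              (c.average (kappa (-s) f) z ^ p * wt (-1) z.1) := by
            refine setLIntegral_mono' measurableSet_upperHalf fun z hz => ?_
            rw [← mul_assoc, ← sq_rpow_half (c.average _ _), ← ENNReal.mul_rpow_of_nonneg _ _ hp2]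
            exact mul_le_mul_left (ENNReal.rpow_le_rpow (hC f hf z hz).2 hp2) _
        _ = C ^ (p / 2) * ∫⁻ z in upperHalf n, c.average (kappa (-s) f) z ^ p * wt (-1) z.1 :=
            lintegral_const_mul' _ _ (ENNReal.rpow_ne_top_of_nonneg hp2 hCt)
        _ ≤ C ^ (p / 2) * N ^ p := by gcongr
        _ = _ := by rw [ENNReal.mul_rpow_of_nonneg _ _ hp2, sq_rpow_half]
    | infinite s α hα =>
      -- The essential supremum gives only an almost everywhere bound; the change of parameters,
      -- from `c` to itself, makes it hold everywhere.
      obtain ⟨C', hC'0, hC't, hC'⟩ := whit_le_of_ae_le (n := n) c c (2 * (s + α))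
      refine ⟨C' * C, mul_ne_zero hC'0 hC0, ENNReal.mul_ne_top hC't hCt, fun f hf N h => ?_⟩
      rw [mul_assoc]
      refine hC' _ _ ?_
      have h1 : ∀ᵐ z ∂haarUpper n, c.average (kappa (-(s + α)) f) z ≤ N := by
        have h2 : eLpNormEssSup (c.average (kappa (-(s + α)) f)) (haarUpper n) ≤ N := by
          rw [← eLpNorm_exponent_top]; exact h
        filter_upwards [ae_le_eLpNormEssSup (f := c.average (kappa (-(s + α)) f))
          (μ := haarUpper n)] with z hz
        exact le_trans (by simpa using hz) h2
      filter_upwards [ae_haarUpper_iff.1 h1, ae_restrict_mem measurableSet_upperHalf] with z hz hz0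
      refine ((hC f hf z hz0).2).trans ?_
      simp only [Exponent.reg]
      gcongr

lemma Scale.norm_le_of_bound (X : Scale) (c : Whitney) (p : Exponent) :
    ∃ C : ℝ≥0∞, C ≠ ∞ ∧ ∀ f : Space n → F, Measurable (fun z => ‖f z‖ₑ) →
      ∀ N : ℝ≥0∞, X.bound c p (fun z => ‖f z‖ₑ ^ 2) (N ^ 2) → X.norm c p f ≤ C * N := by
  cases X with
  | T =>
    cases p with
    | finite p s hp =>
      refine ⟨1, ENNReal.one_ne_top, fun f _ N h => ?_⟩
      rw [one_mul]
      exact (tentNorm_finite_le_iff hp f N).2 h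
    | infinite s α hα =>
      have hκ0 := unitBallVolume_ne_zero (n := n)
      have hκt := unitBallVolume_ne_top (n := n)
      refine ⟨(unitBallVolume n)⁻¹ ^ (1 / 2 : ℝ), ENNReal.rpow_ne_top_of_nonneg (by norm_num)
        (ENNReal.inv_ne_top.2 hκ0), fun f _ N h => ?_⟩
      refine (tentNorm_infinite_le_iff hα f _).2 ?_
      rwa [mul_pow, ← ENNReal.rpow_two, ← ENNReal.rpow_mul, one_div_mul_cancel two_ne_zero,
        ENNReal.rpow_one, ← mul_assoc, ENNReal.mul_inv_cancel hκ0 hκt, one_mul]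
  | Z =>
    obtain ⟨C, hC0, hCt, hC⟩ := average_kappa_comparable (n := n) (F := F) c p.reg
    refine ⟨C ^ (1 / 2 : ℝ), ENNReal.rpow_ne_top_of_nonneg (by norm_num) hCt, ?_⟩
    cases p with
    | finite p s hp =>
      intro f hf N h
      have hp2 : 0 ≤ p / 2 := by positivity
      refine (eLpNorm_le_iff hp _ _).2 ?_
      rw [lintegral_haarUpper]
      simp only [Exponent.reg] at hC ⊢
      calc _ ≤ ∫⁻ z in upperHalf n, C ^ (p / 2) *
              ((wt (-(2 * s)) z.1 * whit c (fun z => ‖f z‖ₑ ^ 2) z) ^ (p / 2) * wt (-1) z.1) := by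
            refine setLIntegral_mono' measurableSet_upperHalf fun z hz => ?_
            rw [← mul_assoc, ← ENNReal.mul_rpow_of_nonneg _ _ hp2, ← rpow_half_rpow]
            gcongr
            exact (hC f hf z hz).1
        _ = C ^ (p / 2) * ∫⁻ z in upperHalf n,
              (wt (-(2 * s)) z.1 * whit c (fun z => ‖f z‖ₑ ^ 2) z) ^ (p / 2) * wt (-1) z.1 :=
            lintegral_const_mul' _ _ (ENNReal.rpow_ne_top_of_nonneg hp2 hCt)
        _ ≤ C ^ (p / 2) * (N ^ 2) ^ (p / 2) := mul_le_mul_right h _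
        _ = _ := by
            rw [ENNReal.mul_rpow_of_nonneg _ _ hp.le, rpow_half_rpow, sq_rpow_half]
    | infinite s α hα =>
      intro f hf N h
      change eLpNorm _ ∞ _ ≤ _
      rw [eLpNorm_exponent_top]
      refine essSup_le_of_ae_le _ (ae_haarUpper_iff.2 ?_)
      filter_upwards [ae_restrict_mem measurableSet_upperHalf] with z hz
      rw [enorm_eq_self]
      refine ((hC f hf z hz).1).trans ?_
      rw [ENNReal.mul_rpow_of_nonneg _ _ (by norm_num : (0 : ℝ) ≤ 1 / 2)]
      gcongr
      rw [rpow_half_le_iff]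
      exact h z hz

end Norms

/-! ### Assembly over the cases of exponents and scales -/

lemma lt_of_embeds_finite (hn : 1 ≤ n) {p q s s' : ℝ} {hp : 0 < p} {hq : 0 < q}
    (hpq : (Exponent.finite p s hp).Embeds n (.finite q s' hq))
    (hne : Exponent.finite p s hp ≠ .finite q s' hq) : p < q := by
  have hn0 : (0 : ℝ) < n := by exact_mod_cast hn
  obtain ⟨h1, h2⟩ := hpq
  simp only [Exponent.θ, Exponent.j] at h1 h2
  rcases lt_trichotomy p q with h | h | h
  · exact h
  · subst h
    exact absurd (by rw [show s = s' by linarith]) hne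
  · have : 1 / p < 1 / q := one_div_lt_one_div_of_lt hq h
    nlinarith

/-- The embeddings with a `Z`-space of finite exponent on the left. -/
lemma controls_Z_finite (hn : 1 ≤ n) {p s : ℝ} (hp : 0 < p) (X₁ : Scale) (c d : Whitney)
    (q : Exponent) (hpq : (Exponent.finite p s hp).Embeds n q) (hne : Exponent.finite p s hp ≠ q) :
    Controls (n := n) (Scale.Z.bound c (.finite p s hp)) (X₁.bound d q) := by
  have hn0 : (0 : ℝ) < n := by exact_mod_cast hn
  have hP : 0 < p / 2 := by positivity
  have hsrc : ∀ e, Controls (n := n) (Scale.Z.bound c (.finite p s hp))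
      (MaxBound (p / 2) (2 * s) e) := fun e => controls_ZBound_MaxBound hP (2 * s) c e
  have hsrc' := fun e => (hsrc e).trans (controls_MaxBound_MaxSupBound hP (2 * s) e)
  cases q with
  | finite q s' hq =>
    have hlt : p < q := lt_of_embeds_finite hn hpq hne
    obtain ⟨h1, h2⟩ := hpq
    simp only [Exponent.θ, Exponent.j] at h1 h2
    have hPQ : p / 2 < q / 2 := by linarith
    -- The embedding relation in squared coordinates: the target regularity is the one supplied by
    -- the Hedberg argument.
    have hσ : 2 * s' = 2 * s - n / (p / 2) + n / (q / 2) := by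
      have : s' = s - n * (1 / p - 1 / q) := by linarith
      rw [this]; field_simp; ring
    cases X₁ with
    | T =>
      change Controls _ (TBound (q / 2) (2 * s'))
      rw [hσ]
      exact (hsrc' bigWhitney).trans (controls_MaxSupBound_TBound hn hP hPQ _)
    | Z =>
      change Controls _ (ZBound (q / 2) (2 * s') d)
      rw [hσ]
      exact (hsrc' d).trans (controls_MaxSupBound_ZBound hn hP hPQ _ d)
  | infinite s' α hα =>
    obtain ⟨h1, h2⟩ := hpq
    simp only [Exponent.θ, Exponent.j] at h1 h2
    have hs' : s' = s - n / p - α := by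
      field_simp at h1 ⊢
      linarith
    cases X₁ with
    | T =>
      change Controls _ (TBoundTop (2 * α) (2 * s'))
      rw [show 2 * s' = 2 * s - n / (p / 2) - 2 * α by rw [hs']; field_simp]
      exact (hsrc' bigWhitney).trans (controls_MaxSupBound_TBoundTop hn hP (by positivity) _)
    | Z =>
      change Controls _ (ZBoundTop (2 * (s' + α)) d)
      rw [show 2 * (s' + α) = 2 * s - n / (p / 2) by rw [hs']; field_simp; ring]
      exact (hsrc d).trans (controls_MaxBound_ZBoundTop hP _ d)

/-- A tent space with finite exponent embeds into a `Z`-space of larger integrability. -/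
lemma controls_T_Z_finite (hn : 1 ≤ n) {p q s : ℝ} (hp : 0 < p) (hq : 0 < q) (hpq : p < q)
    (c : Whitney) : Controls (n := n) (Scale.T.bound c (.finite p s hp))
      (Scale.Z.bound smallWhitney (.finite q (s - n / p + n / q) hq)) := by
  have hP : 0 < p / 2 := by positivity
  change Controls (TBound (p / 2) (2 * s)) (ZBound (q / 2) (2 * (s - n / p + n / q)) smallWhitney)
  rw [show 2 * (s - n / p + n / q) = 2 * s - n / (p / 2) + n / (q / 2) by field_simp]
  exact ((controls_TBound_MaxBound hP _).trans (controls_MaxBound_MaxSupBound hP _ _)).trans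
    (controls_MaxSupBound_ZBound hn hP (by linarith) _ _)

lemma controls_bound (hn : 1 ≤ n) (X₀ X₁ : Scale) (c d : Whitney) (p q : Exponent)
    (hpq : p.Embeds n q) (hne : p ≠ q) :
    Controls (n := n) (X₀.bound c p) (X₁.bound d q) := by
  have hn0 : (0 : ℝ) < n := by exact_mod_cast hn
  cases p with
  | finite p s hp =>
    cases X₀ with
    | Z => exact controls_Z_finite hn hp X₁ c d q hpq hne
    | T =>
      -- An exponent strictly between `p` and `q` on the same embedding line. Strictness on both
      -- sides is needed since each of the two embeddings raises integrability.
      have hmid : ∃ m : ℝ, ∃ hm : 0 < m, p < m ∧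
          (Exponent.finite m (s - n / p + n / m) hm).Embeds n q ∧
          Exponent.finite m (s - n / p + n / m) hm ≠ q := by
        cases q with
        | finite q s' hq =>
          have hlt : p < q := lt_of_embeds_finite hn hpq hne
          obtain ⟨h1, h2⟩ := hpq
          simp only [Exponent.θ, Exponent.j] at h1 h2
          have hm : 0 < (p + q) / 2 := by positivity
          refine ⟨(p + q) / 2, hm, by linarith, ⟨?_, ?_⟩, ?_⟩
          · simp only [Exponent.θ, Exponent.j]
            linear_combination h1
          · simp only [Exponent.θ]
            have : 1 / q ≤ 1 / ((p + q) / 2) := one_div_le_one_div_of_le hm (by linarith)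
            have h3 := mul_le_mul_of_nonneg_left this hn0.le
            rw [div_eq_mul_one_div (n : ℝ) p, div_eq_mul_one_div (n : ℝ) ((p + q) / 2)]
            linarith
          · intro h
            injection h with h _
            linarith
        | infinite s' α hα =>
          obtain ⟨h1, h2⟩ := hpq
          simp only [Exponent.θ, Exponent.j] at h1 h2
          have hm : 0 < p + 1 := by positivity
          refine ⟨p + 1, hm, by linarith, ⟨?_, ?_⟩, by simp⟩
          · simp only [Exponent.θ, Exponent.j]
            linear_combination h1
          · simp only [Exponent.θ]
            have h3 : 0 < n / (p + 1) := by positivity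
            have h4 : s - s' = n / p + α := by
              rw [h1]; field_simp; ring
            linarith
      obtain ⟨m, hm, hpm, hE, hN⟩ := hmid
      exact (controls_T_Z_finite hn hp hm hpm c).trans
        (controls_Z_finite hn hm X₁ smallWhitney d q hE hN)
  | infinite s α hα =>
    obtain ⟨h1, h2⟩ := hpq
    cases q with
    | finite q s' hq =>
      -- The relation would give `θ(p) - θ(q) = -α - n / q < 0`.
      exfalso
      simp only [Exponent.θ, Exponent.j] at h1 h2
      have h3 : 0 < (n : ℝ) * (1 / q) := by positivity
      have h4 : (n : ℝ) * (-α / n) = -α := mul_div_cancel₀ _ hn0.ne'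
      rw [mul_sub, h4] at h1
      linarith
    | infinite s' α' hα' =>
      simp only [Exponent.θ, Exponent.j] at h1 h2
      have h3 : s + α = s' + α' := by
        rw [mul_sub, mul_div_cancel₀ _ hn0.ne', mul_div_cancel₀ _ hn0.ne'] at h1
        linarith
      -- `α'` is `α` plus the drop in regularity; a zero drop would make the exponents equal.
      have hα'' : 0 < α' := by
        rcases lt_or_eq_of_le h2 with h | h
        · linarith
        · subst h
          exact absurd (by simp; linarith) hne
      have hsrc : Controls (n := n) (X₀.bound c (.infinite s α hα))
          (ZBoundTop (2 * (s' + α')) d) := by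
        rw [← h3]
        cases X₀ with
        | T =>
          rw [mul_add]
          exact controls_TBoundTop_ZBoundTop (2 * s) d
        | Z => exact controls_ZBoundTop_ZBoundTop _ c d
      cases X₁ with
      | T =>
        refine hsrc.trans ?_
        have := controls_ZBoundTop_TBoundTop (n := n) (A := 2 * α') (by positivity)
          (2 * (s' + α')) d
        rwa [show 2 * (s' + α') - 2 * α' = 2 * s' by ring] at this
      | Z => exact hsrc

lemma Scale.norm_le (hn : 1 ≤ n) {F : Type*} [NormedAddCommGroup F] [NormedSpace ℝ F]
    (X₀ X₁ : Scale) (c d : Whitney) (p q : Exponent) (hpq : p.Embeds n q) (hne : p ≠ q) :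
    ∃ C : ℝ≥0, ∀ f : Space n → F, Measurable (fun z => ‖f z‖ₑ) → X₀.norm c p f < ∞ →
      X₁.norm d q f ≤ C * X₀.norm c p f := by
  obtain ⟨C₁, h10, h1t, h1⟩ := X₀.bound_of_norm_le (n := n) (F := F) c p
  obtain ⟨C₂, h20, h2t, h2⟩ := controls_bound hn X₀ X₁ c d p q hpq hne
  obtain ⟨C₃, h3t, h3⟩ := X₁.norm_le_of_bound (n := n) (F := F) d q
  set K : ℝ≥0∞ := C₃ * (C₂ * C₁) ^ (1 / 2 : ℝ) with hK
  have hKt : K ≠ ∞ := ENNReal.mul_ne_top h3t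
    (ENNReal.rpow_ne_top_of_nonneg (by norm_num) (ENNReal.mul_ne_top h2t h1t))
  refine ⟨K.toNNReal, fun f hf hfin => ?_⟩
  rw [ENNReal.coe_toNNReal hKt]
  have key : ∀ N : ℝ≥0∞, N ≠ 0 → N ≠ ∞ → X₀.norm c p f ≤ N → X₁.norm d q f ≤ K * N := by
    intro N hN0 hNt hN
    have hb := h2 _ (hf.pow_const 2) _ (mul_ne_zero h10 (pow_ne_zero 2 hN0))
      (ENNReal.mul_ne_top h1t (ENNReal.pow_ne_top hNt)) (h1 f hf N hN)
    rw [hK, mul_assoc]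
    refine h3 f hf _ ?_
    rwa [mul_pow, ← ENNReal.rpow_two ((C₂ * C₁) ^ (1 / 2 : ℝ)), ← ENNReal.rpow_mul,
      one_div_mul_cancel two_ne_zero, ENNReal.rpow_one, mul_assoc]
  -- The bounds require nonzero `M`, so a vanishing norm is treated by letting the majorant `N` tend
  -- to zero.
  rcases eq_or_ne (X₀.norm c p f) 0 with h0 | h0
  · rw [h0, mul_zero]
    refine ENNReal.le_of_forall_pos_le_add fun ε hε _ => ?_
    rw [zero_add]
    have hN0 : (ε : ℝ≥0∞) / (K + 1) ≠ 0 := by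
      simp [ENNReal.div_eq_zero_iff, hε.ne', hKt]
    have hNt : (ε : ℝ≥0∞) / (K + 1) ≠ ∞ := by simp [ENNReal.div_eq_top]
    refine (key _ hN0 hNt (by simp [h0])).trans ?_
    calc K * (ε / (K + 1)) ≤ (K + 1) * (ε / (K + 1)) := by gcongr; exact le_self_add
      _ ≤ ε := ENNReal.mul_div_le
  · exact key _ h0 hfin.ne le_rfl

end

end FractionalData

theorem theorem2p34 (n : ℕ) (hn : 1 ≤ n)
    (F : Type*) [NormedAddCommGroup F] [NormedSpace ℝ F]
    (X₀ X₁ : FractionalData.Scale) (c d : FractionalData.Whitney)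
    (p q : FractionalData.Exponent) (hpq : p.Embeds n q) (hne : p ≠ q) :
    X₀.space n F c p ⊆ X₁.space n F d q ∧
      ∃ C : ℝ≥0, ∀ f ∈ X₀.space n F c p, X₁.qnorm d q f ≤ C * X₀.qnorm c p f := by
  obtain ⟨C, hC⟩ := FractionalData.Scale.norm_le hn (F := F) X₀ X₁ c d p q hpq hne
  have hq : ∀ (X : FractionalData.Scale) (e : FractionalData.Whitney)
      (r : FractionalData.Exponent) (f : FractionalData.L0 n F),
      X.qnorm e r f = X.norm e r f := by
    intro X e r f
    cases X <;> rfl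
  have key : ∀ f ∈ X₀.space n F c p, X₁.qnorm d q f ≤ C * X₀.qnorm c p f := by
    intro f hf
    rw [hq, hq]
    refine hC f f.stronglyMeasurable.enorm ?_
    rw [← hq]
    exact hf
  exact ⟨fun f hf => (key f hf).trans_lt (ENNReal.mul_lt_top ENNReal.coe_lt_top hf), C, key⟩
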